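/- Let $KS_0$ be the equilateral triangle of side length $1$ in the plane whose base is the interval $I=[0,1]$ of the horizontal axis (third vertex above it). Let $KS_{n+1}$ be obtained from $KS_n$ by replacing the open middle third of each side with the two other sides of the equilateral triangle built outwards on it. Let $\Omega(KS_n)$ be the compact region bounded by $KS_n$, regarded as a billiard table. Directions are measured in the fixed coordinate system. A state of the billiard is a boundary point together with an inward pointing unit vector. An orbit is periodic if it never hits a corner and returns to its initial state. Its period $\#\mathcal O$ is the least positive number of collisions after which it returns to its initial state, and its length $|\mathcal O|$ is the length of the path traced out over one period by connecting consecutive base points. A compatible sequence of periodic orbits in the direction $\pi/3$ is a sequence $(\mathcal O_n)_{n\ge 0}$ such that, for each $n$, $\mathcal O_n$ is a periodic orbit of $\Omega(KS_n)$ with initial base point $x_n^0\in KS_n$ (not a corner) and initial direction $\pi/3$ (inward pointing at $x_n^0$), where $x_n^0$ lies on the line through $x_0^0$ in the direction $\pi/3$ and no point of $KS_n$ lies strictly between $x_0^0$ and $x_n^0$. Then $x_0^0\in I$. For a ternary expansion of $x_0^0$, let $(x_0^0)_i\in\{0,1,2\}$ be its $i$-th digit ($i\ge1$), and put $\chi[1]=1$,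 $\chi[0]=\chi[2]=0$. **Theorem.** Let $(\mathcal O_n)_{n\ge0}$ be a compatible sequence of periodic orbits in the direction $\pi/3$, and let $\mathscr L$ be the length of the Fagnano orbit of $\Omega(KS_0)$, i.e. the orbit starting at the midpoint $1/2$ of the base in the direction $\pi/3$. Then for every $n\ge 0$, except when $n=0$ and $x_0^0=1/2$, $$|\mathcal O_n| = 2\mathscr L+\sum_{i=2}^{n}\chi\big[(x_0^0)_i\big]\,\#\mathcal O_{i-1}\,\frac{\mathscr L}{3^i},$$ where the sum is empty for $n\le 1$. In the exceptional case $n=0$, $x_0^0=1/2$, one has $|\mathcal O_0|=\mathscr L$. -/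

import Mathlib

open Filter Topology

namespace KochBilliard

noncomputable section

/-- The unit vector making the angle `θ` with the positive horizontal axis of the plane `ℂ`. -/
def dir (θ : ℝ) : ℂ := Complex.exp (θ * Complex.I)

/-- The point of the segment from `a` to `b` at one third of the way. -/
def oneThird (a b : ℂ) : ℂ := a + (b - a) / 3

/-- The point of the segment from `a` to `b` at two thirds of the way. -/
def twoThird (a b : ℂ) : ℂ := a + 2 * (b - a) / 3

/-- The third vertex of the equilateral triangle erected on the middle third of the segment from
`a` to `b`, on the right-hand side of a traveller going from `a` to `b`. -/
def apex (a b : ℂ) : ℂ := oneThird a b + (b - a) / 3 * dir (-(Real.pi / 3))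

/-- The sides of the `n`-th inner polygonal approximation of the Koch snowflake, listed
counterclockwise, each as an ordered pair of end points. The polygon of level `0` is the
equilateral triangle whose base is the unit interval; at each step the open middle third of every
side is replaced by the two other sides of an equilateral triangle pointing outwards. -/
def sides : ℕ → List (ℂ × ℂ)
  | 0 => [(0, 1), (1, dir (Real.pi / 3)), (dir (Real.pi / 3), 0)]
  | n + 1 => (sides n).flatMap fun s =>
      [(s.1, oneThird s.1 s.2), (oneThird s.1 s.2, apex s.1 s.2),
        (apex s.1 s.2, twoThird s.1 s.2), (twoThird s.1 s.2, s.2)]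

/-- The prefractal curve `KS_n`, i.e. the union of its sides. -/
def KS (n : ℕ) : Set ℂ := {z | ∃ s ∈ sides n, z ∈ segment ℝ s.1 s.2}

/-- The cell glued to the middle third of a side: a solid equilateral triangle. -/
def cell (s : ℂ × ℂ) : Set ℂ :=
  convexHull ℝ {oneThird s.1 s.2, apex s.1 s.2, twoThird s.1 s.2}

/-- The billiard table `Ω(KS_n)`, the compact region bounded by `KS_n`: the solid equilateral
triangle together with all the cells glued to it up to level `n`. -/
def table : ℕ → Set ℂ
  | 0 => convexHull ℝ {0, 1, dir (Real.pi / 3)}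
  | n + 1 => table n ∪ ⋃ s ∈ sides n, cell s

/-- `x` is a point of `KS_n` which is not a corner, and the vector `v` based at `x` points into the
interior of the table `Ω(KS_n)`. -/
def PointsInward (n : ℕ) (x v : ℂ) : Prop :=
  (∃ s ∈ sides n, x ∈ openSegment ℝ s.1 s.2) ∧
    ∀ᶠ t : ℝ in 𝓝[>] 0, x + (t : ℂ) * v ∈ interior (table n)

/-- One step of the billiard map of `Ω(KS_n)`. A state is a pair (base point, inward unit vector).
From the state `p` the ball moves along a straight line until it first meets `KS_n` again, at the
base point of `q`; this point must lie in the relative interior of a side (the ball does not hit a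
corner), and the new direction is the mirror image of the old one in that side. -/
def BilliardStep (n : ℕ) (p q : ℂ × ℂ) : Prop :=
  ∃ t : ℝ, 0 < t ∧ q.1 = p.1 + (t : ℂ) * p.2 ∧
    (∀ r : ℝ, 0 < r → r < t → p.1 + (r : ℂ) * p.2 ∉ KS n) ∧
    ∃ s ∈ sides n, q.1 ∈ openSegment ℝ s.1 s.2 ∧
      q.2 = (Submodule.span ℝ {s.2 - s.1}).reflection p.2

/-- `q` is the (nonsingular) orbit of the billiard `Ω(KS_n)` with initial base point `x` and
initial inward pointing direction `θ`, measured in the fixed coordinate system. -/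
structure IsOrbit (n : ℕ) (x : ℂ) (θ : ℝ) (q : ℕ → ℂ × ℂ) : Prop where
  init : q 0 = (x, dir θ)
  inward : PointsInward n x (dir θ)
  step : ∀ k, BilliardStep n (q k) (q (k + 1))

/-- The orbit returns to its initial state. -/
def IsClosedOrbit (q : ℕ → ℂ × ℂ) : Prop := ∃ k, 0 < k ∧ q k = q 0

/-- The period of a closed orbit: the least positive number of steps after which it returns to its
initial state. -/
def period (q : ℕ → ℂ × ℂ) : ℕ := sInf {k | 0 < k ∧ q k = q 0}

/-- The length of the path traced out by connecting the consecutive base points of a closed orbit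
over one period. -/
def pathLength (q : ℕ → ℂ × ℂ) : ℝ :=
  ∑ k ∈ Finset.range (period q), dist (q k).1 (q (k + 1)).1

/-- `O n`, for `n ≥ 0`, form a compatible sequence of periodic orbits in the direction `θ`:
`O n` is a periodic (closed and nonsingular) orbit of `Ω(KS_n)` with initial direction `θ`, whose
initial base point is collinear with the initial base point of `O 0` in the direction `θ`, with no
points of `KS_n` strictly between them. -/
structure IsCompatiblePeriodicSequence (θ : ℝ) (O : ℕ → ℕ → ℂ × ℂ) : Prop where
  orbit : ∀ n, IsOrbit n (O n 0).1 θ (O n)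
  closed : ∀ n, IsClosedOrbit (O n)
  collinear : ∀ n, ∃ t : ℝ, (O n 0).1 = (O 0 0).1 + (t : ℂ) * dir θ
  visible : ∀ n z, Sbtw ℝ (O 0 0).1 z (O n 0).1 → z ∉ KS n

/-- The characteristic function of the ternary digit `1`. -/
def chi (a : Fin 3) : ℝ := if a = 1 then 1 else 0

end

end KochBilliard

/-! ### Combinatorics of the prefractals on triangular lattices. -/

namespace KochBilliard

/-! The sides of KS_n are edges of the triangular lattice of mesh 3⁻ⁿ, and reflections in them
permute the lattice directions, so the ball always moves along lattice directions. A ball leaving a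
side at parameter u meets the next side at 1 - u, whatever u in (0,1) is: a whole parallel beam
visits the same sides, and the flight time, in the unit 3⁻ⁿ, is B - u or, for a reversed chord, B -
(1 - u). An orbit is thus described by a cyclic itinerary of N sides with constants B_j
(`IsItinerary`). If N is even, then u and 1 - u balance, the period is N and the length is (∑ B_j -
N/2)/3ⁿ (`IsItinerary.pathLength_eq_of_even`).

The next ternary digit tells which third of the sides is hit. For the digits 0 and 2 the ball hits
first and last thirds alternately, and the constants become 3B and 3B - 2 in turn
(`IsItinerary.third`); for even N both period and length persist. For the digit 1 each collision is
replaced by two collisions inside the cell glued to the side: the old flights are prolonged into the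
cells, with constant 3B, and a flight with constant 1 is inserted in each cell
(`IsItinerary.cellSide`). So N doubles and the length grows by (N/2)/3ⁿ = N·(3/2)/3ⁿ⁺¹, where 3/2 is
the length of the Fagnano orbit. In the triangle N = 3 is odd; either refinement leads to N = 6 and
length 3 on level 1, which is why the first digit does not contribute.

Two points need care. Flights must not meet the curve too early, now or after refinement; this is
controlled by `Safe`, which passes from each level to the next. And the initial base point on each
level must be the one predicted by the itinerary, which `IsStart.eq_of_visible` derives from
visibility and inwardness. Nonsingularity makes 3ⁿx a non-integer for all n, so that u is always an
inner parameter. -/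

/-- A directed edge of the triangular lattice, from the lattice point `(p, q)` to the lattice point
`(p + v, q + w)`, in the basis formed by `1` and `dir (π / 3)`. -/
@[ext] structure LatticeEdge where
  p : ℤ
  q : ℤ
  v : ℤ
  w : ℤ

namespace LatticeEdge

/-- The direction of the edge is one of the six unit vectors of the lattice. -/
def HasUnitStep (e : LatticeEdge) : Prop :=
  (e.v = 1 ∧ e.w = 0) ∨ (e.v = 0 ∧ e.w = 1) ∨ (e.v = -1 ∧ e.w = 1) ∨
    (e.v = -1 ∧ e.w = 0) ∨ (e.v = 0 ∧ e.w = -1) ∨ (e.v = 1 ∧ e.w = -1)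

/-- The first third of an edge, on the three times finer lattice. -/
def first (e : LatticeEdge) : LatticeEdge := ⟨3 * e.p, 3 * e.q, e.v, e.w⟩

/-- The middle third of an edge, on the three times finer lattice. -/
def middle (e : LatticeEdge) : LatticeEdge := ⟨3 * e.p + e.v, 3 * e.q + e.w, e.v, e.w⟩

/-- The last third of an edge, on the three times finer lattice. -/
def last (e : LatticeEdge) : LatticeEdge := ⟨3 * e.p + 2 * e.v, 3 * e.q + 2 * e.w, e.v, e.w⟩

/-- The side of the cell of an edge that leads to the apex. -/
def toApex (e : LatticeEdge) : LatticeEdge :=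
  ⟨3 * e.p + e.v, 3 * e.q + e.w, e.v + e.w, -e.v⟩

/-- The side of the cell of an edge that comes from the apex. -/
def fromApex (e : LatticeEdge) : LatticeEdge :=
  ⟨3 * e.p + 2 * e.v + e.w, 3 * e.q + e.w - e.v, -e.w, e.v + e.w⟩

/-- Lower bounds of the coordinates `a`, `b`, `a + b` on the lattice triangle to the left of an
edge. -/
def left (e : LatticeEdge) : ℤ × ℤ × ℤ :=
  (e.p + min 0 (min e.v (-e.w)), e.q + min 0 (min e.w (e.v + e.w)),
    e.p + e.q + min 0 (min (e.v + e.w) e.v))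

/-- Lower bounds of the coordinates `a`, `b`, `a + b` on the lattice triangle to the right of an
edge. -/
def right (e : LatticeEdge) : ℤ × ℤ × ℤ :=
  (e.p + min 0 (min e.v (e.v + e.w)), e.q + min 0 (min e.w (-e.v)),
    e.p + e.q + min 0 (min (e.v + e.w) e.w))

end LatticeEdge

open LatticeEdge

/-- The sides of `KS_n`, as edges of the lattice of mesh `3⁻ⁿ`. -/
def IsSide : ℕ → LatticeEdge → Prop
  | 0, e => e = ⟨0, 0, 1, 0⟩ ∨ e = ⟨1, 0, -1, 1⟩ ∨ e = ⟨0, 1, 0, -1⟩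
  | n + 1, e => ∃ f, IsSide n f ∧
      (e = f.first ∨ e = f.toApex ∨ e = f.fromApex ∨ e = f.last)

/-- The coarse lattice triangle containing a given triangle of the three times finer lattice. -/
def coarse (τ : ℤ × ℤ × ℤ) : ℤ × ℤ × ℤ := (τ.1 / 3, τ.2.1 / 3, τ.2.2 / 3)

/-- The lattice triangles of mesh `3⁻ⁿ` which make up the table `Ω(KS_n)`. -/
def InTable : ℕ → ℤ × ℤ × ℤ → Prop
  | 0, τ => τ = (0, 0, 0)
  | n + 1, τ => InTable n (coarse τ) ∨ ∃ f, IsSide n f ∧ τ = f.toApex.left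

theorem IsSide.first {n : ℕ} {e : LatticeEdge} (h : IsSide n e) : IsSide (n + 1) e.first :=
  ⟨e, h, Or.inl rfl⟩

theorem IsSide.toApex {n : ℕ} {e : LatticeEdge} (h : IsSide n e) : IsSide (n + 1) e.toApex :=
  ⟨e, h, Or.inr (Or.inl rfl)⟩

theorem IsSide.fromApex {n : ℕ} {e : LatticeEdge} (h : IsSide n e) : IsSide (n + 1) e.fromApex :=
  ⟨e, h, Or.inr (Or.inr (Or.inl rfl))⟩

theorem IsSide.last {n : ℕ} {e : LatticeEdge} (h : IsSide n e) : IsSide (n + 1) e.last :=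
  ⟨e, h, Or.inr (Or.inr (Or.inr rfl))⟩

theorem IsSide.hasUnitStep {n : ℕ} {e : LatticeEdge} (h : IsSide n e) : e.HasUnitStep := by
  induction n generalizing e with
  | zero => rcases h with rfl | rfl | rfl <;> simp [HasUnitStep]
  | succ n ih =>
    obtain ⟨f, hf, h⟩ := h
    have := ih hf
    unfold HasUnitStep at this ⊢
    rcases h with rfl | rfl | rfl | rfl <;>
      simp only [LatticeEdge.first, LatticeEdge.toApex, LatticeEdge.fromApex,
        LatticeEdge.last] <;> omega

theorem coarse_left_first {e : LatticeEdge} (h : e.HasUnitStep) : coarse e.first.left = e.left := by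
  obtain ⟨p, q, v, w⟩ := e
  simp only [HasUnitStep] at h
  simp only [coarse, left, LatticeEdge.first, Prod.mk.injEq]
  omega

theorem coarse_left_middle {e : LatticeEdge} (h : e.HasUnitStep) : coarse e.middle.left = e.left := by
  obtain ⟨p, q, v, w⟩ := e
  simp only [HasUnitStep] at h
  simp only [coarse, left, LatticeEdge.middle, Prod.mk.injEq]
  omega

theorem coarse_left_last {e : LatticeEdge} (h : e.HasUnitStep) : coarse e.last.left = e.left := by
  obtain ⟨p, q, v, w⟩ := e
  simp only [HasUnitStep] at h
  simp only [coarse, left, LatticeEdge.last, Prod.mk.injEq]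
  omega

theorem left_fromApex {e : LatticeEdge} (h : e.HasUnitStep) : e.fromApex.left = e.toApex.left := by
  obtain ⟨p, q, v, w⟩ := e
  simp only [HasUnitStep] at h
  simp only [left, LatticeEdge.fromApex, LatticeEdge.toApex, Prod.mk.injEq]
  omega

/-- The cell lies between the removed middle third and the two new sides. -/
theorem right_middle {e : LatticeEdge} (h : e.HasUnitStep) : e.middle.right = e.toApex.left := by
  obtain ⟨p, q, v, w⟩ := e
  simp only [HasUnitStep] at h
  simp only [left, right, LatticeEdge.middle, LatticeEdge.toApex, Prod.mk.injEq]
  omega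

/-- The cell fills only the middle of its side, so outside the new sides one is still in the coarse
triangle outside the old side. -/
theorem coarse_right_child {e f : LatticeEdge} (h : f.HasUnitStep)
    (he : e = f.first ∨ e = f.toApex ∨ e = f.fromApex ∨ e = f.last) :
    coarse e.right = f.right := by
  obtain ⟨p, q, v, w⟩ := f
  simp only [HasUnitStep] at h
  rcases he with rfl | rfl | rfl | rfl <;>
  simp only [coarse, right, LatticeEdge.first, LatticeEdge.toApex, LatticeEdge.fromApex,
    LatticeEdge.last, Prod.mk.injEq] <;>
  omega

/-- A signature modulo 3 of the position of a cell in its coarse triangle: exactly two of the three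
residues are 1. It separates cells from the triangles outside the new sides. -/
theorem residues_toApex_left {g : LatticeEdge} (hg : g.HasUnitStep) :
    (g.toApex.left.1 % 3 = 1 ∧ g.toApex.left.2.1 % 3 = 1 ∧ g.toApex.left.2.2 % 3 ≠ 1) ∨
    (g.toApex.left.1 % 3 = 1 ∧ g.toApex.left.2.1 % 3 ≠ 1 ∧ g.toApex.left.2.2 % 3 = 1) ∨
    (g.toApex.left.1 % 3 ≠ 1 ∧ g.toApex.left.2.1 % 3 = 1 ∧ g.toApex.left.2.2 % 3 = 1) := by
  obtain ⟨p, q, v, w⟩ := g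
  simp only [HasUnitStep] at hg
  simp only [left, LatticeEdge.toApex]
  rcases hg with ⟨rfl, rfl⟩ | ⟨rfl, rfl⟩ | ⟨rfl, rfl⟩ | ⟨rfl, rfl⟩ | ⟨rfl, rfl⟩ | ⟨rfl, rfl⟩ <;>
  omega

theorem right_child_ne {e f g : LatticeEdge} (h : f.HasUnitStep) (hg : g.HasUnitStep)
    (he : e = f.first ∨ e = f.toApex ∨ e = f.fromApex ∨ e = f.last) :
    e.right ≠ g.toApex.left := by
  intro heq
  have := residues_toApex_left hg
  rw [← heq] at this
  clear heq hg
  obtain ⟨p, q, v, w⟩ := f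
  simp only [HasUnitStep] at h
  rcases he with rfl | rfl | rfl | rfl <;>
  simp only [right, LatticeEdge.first, LatticeEdge.toApex, LatticeEdge.fromApex,
    LatticeEdge.last] at this <;>
  rcases h with ⟨rfl, rfl⟩ | ⟨rfl, rfl⟩ | ⟨rfl, rfl⟩ | ⟨rfl, rfl⟩ | ⟨rfl, rfl⟩ | ⟨rfl, rfl⟩ <;>
  omega

theorem IsSide.left_inTable {n : ℕ} {e : LatticeEdge} (h : IsSide n e) : InTable n e.left := by
  induction n generalizing e with
  | zero => rcases h with rfl | rfl | rfl <;> simp [InTable, left]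
  | succ n ih =>
    obtain ⟨f, hf, h⟩ := h
    have hu := hf.hasUnitStep
    rcases h with rfl | rfl | rfl | rfl
    · exact Or.inl (by rw [coarse_left_first hu]; exact ih hf)
    · exact Or.inr ⟨f, hf, rfl⟩
    · exact Or.inr ⟨f, hf, left_fromApex hu⟩
    · exact Or.inl (by rw [coarse_left_last hu]; exact ih hf)

theorem IsSide.right_not_inTable {n : ℕ} {e : LatticeEdge} (h : IsSide n e) :
    ¬ InTable n e.right := by
  induction n generalizing e with
  | zero => rcases h with rfl | rfl | rfl <;> simp [InTable, right]
  | succ n ih =>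
    obtain ⟨f, hf, h⟩ := h
    rintro (h1 | ⟨g, hg, h1⟩)
    · rw [coarse_right_child hf.hasUnitStep h] at h1
      exact ih hf h1
    · exact right_child_ne hf.hasUnitStep hg.hasUnitStep h h1

/-- An edge of a cell is one of its two free sides, or its base. -/
theorem eq_of_left_eq_cell {e g : LatticeEdge} (he : e.HasUnitStep) (hg : g.HasUnitStep)
    (h : e.left = g.toApex.left) :
    e = g.toApex ∨ e = g.fromApex ∨ coarse e.right = g.left := by
  obtain ⟨p, q, v, w⟩ := e
  obtain ⟨p', q', v', w'⟩ := g
  simp only [HasUnitStep] at he hg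
  simp only [left, right, coarse, LatticeEdge.toApex, LatticeEdge.fromApex, Prod.mk.injEq,
    LatticeEdge.mk.injEq] at h ⊢
  rcases he with ⟨rfl, rfl⟩ | ⟨rfl, rfl⟩ | ⟨rfl, rfl⟩ | ⟨rfl, rfl⟩ | ⟨rfl, rfl⟩ | ⟨rfl, rfl⟩ <;>
  rcases hg with ⟨rfl, rfl⟩ | ⟨rfl, rfl⟩ | ⟨rfl, rfl⟩ | ⟨rfl, rfl⟩ | ⟨rfl, rfl⟩ | ⟨rfl, rfl⟩ <;>
  norm_num at h ⊢ <;> omega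

/-- An edge that separates two triangles of the coarse lattice is a third of a coarse edge. -/
theorem exists_coarse_edge {e : LatticeEdge} (he : e.HasUnitStep)
    (h : coarse e.left ≠ coarse e.right) :
    ∃ f : LatticeEdge, f.HasUnitStep ∧ f.left = coarse e.left ∧ f.right = coarse e.right ∧
      (e = f.first ∨ e = f.middle ∨ e = f.last) := by
  obtain ⟨p, q, v, w⟩ := e
  simp only [HasUnitStep, left, right, coarse, LatticeEdge.first, LatticeEdge.middle, LatticeEdge.last,
    ne_eq, Prod.mk.injEq] at he h ⊢
  rcases he with ⟨rfl, rfl⟩ | ⟨rfl, rfl⟩ | ⟨rfl, rfl⟩ | ⟨rfl, rfl⟩ | ⟨rfl, rfl⟩ | ⟨rfl, rfl⟩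
  -- Off the coarse lattice lines, both triangles at the edge have the same coarse triple. The other
  -- five directions are analogous.
  · have hd : q % 3 = 0 := by
      by_contra hd
      exact h ⟨by omega, by omega, by omega⟩
    refine ⟨⟨p / 3, q / 3, 1, 0⟩, by norm_num, ?_, ?_, ?_⟩ <;>
      norm_num [LatticeEdge.mk.injEq] <;> omega
  · have hd : p % 3 = 0 := by
      by_contra hd
      exact h ⟨by omega, by omega, by omega⟩
    refine ⟨⟨p / 3, q / 3, 0, 1⟩, by norm_num, ?_, ?_, ?_⟩ <;>
      norm_num [LatticeEdge.mk.injEq] <;> omega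
  · have hd : (p + q) % 3 = 0 := by
      by_contra hd
      exact h ⟨by omega, by omega, by omega⟩
    refine ⟨⟨(p + 2) / 3, q / 3, -1, 1⟩, by norm_num, ?_, ?_, ?_⟩ <;>
      norm_num [LatticeEdge.mk.injEq] <;> omega
  · have hd : q % 3 = 0 := by
      by_contra hd
      exact h ⟨by omega, by omega, by omega⟩
    refine ⟨⟨(p + 2) / 3, q / 3, -1, 0⟩, by norm_num, ?_, ?_, ?_⟩ <;>
      norm_num [LatticeEdge.mk.injEq] <;> omega
  · have hd : p % 3 = 0 := by
      by_contra hd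
      exact h ⟨by omega, by omega, by omega⟩
    refine ⟨⟨p / 3, (q + 2) / 3, 0, -1⟩, by norm_num, ?_, ?_, ?_⟩ <;>
      norm_num [LatticeEdge.mk.injEq] <;> omega
  · have hd : (p + q) % 3 = 0 := by
      by_contra hd
      exact h ⟨by omega, by omega, by omega⟩
    refine ⟨⟨p / 3, (q + 2) / 3, 1, -1⟩, by norm_num, ?_, ?_, ?_⟩ <;>
      norm_num [LatticeEdge.mk.injEq] <;> omega

/-- The sides are all the edges with a triangle of the table on the left only. -/
theorem isSide_of_left_right {n : ℕ} {e : LatticeEdge} (he : e.HasUnitStep)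
    (hl : InTable n e.left) (hr : ¬ InTable n e.right) : IsSide n e := by
  induction n generalizing e with
  | zero =>
    obtain ⟨p, q, v, w⟩ := e
    simp only [HasUnitStep, InTable, IsSide, left, right, Prod.mk.injEq, LatticeEdge.mk.injEq] at *
    rcases he with ⟨rfl, rfl⟩ | ⟨rfl, rfl⟩ | ⟨rfl, rfl⟩ | ⟨rfl, rfl⟩ | ⟨rfl, rfl⟩ | ⟨rfl, rfl⟩ <;>
    norm_num at * <;> omega
  | succ n ih =>
    have hr' : ¬ InTable n (coarse e.right) := fun h => hr (Or.inl h)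
    rcases hl with hl | ⟨g, hg, hl⟩
    · obtain ⟨f, hf, hfl, hfr, h⟩ := exists_coarse_edge he (fun h => hr' (h ▸ hl))
      have hfs : IsSide n f := ih hf (hfl ▸ hl) (hfr ▸ hr')
      rcases h with rfl | rfl | rfl
      · exact hfs.first
      · exact absurd (Or.inr ⟨f, hfs, right_middle hf⟩) hr
      · exact hfs.last
    · rcases eq_of_left_eq_cell he hg.hasUnitStep hl with rfl | rfl | h
      · exact hg.toApex
      · exact hg.fromApex
      · exact absurd (h ▸ hg.left_inTable) hr'

/-! ### Oblique coordinates and the frames of edges. -/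

/-- The point of the plane with the coordinates `a`, `b` in the basis `1`, `dir (π / 3)`. -/
noncomputable def pt (a b : ℝ) : ℂ := a + b * dir (Real.pi / 3)

/-- The first coordinate of a point in the basis `1`, `dir (π / 3)`. -/
noncomputable def coordA (z : ℂ) : ℝ := z.re - z.im / √3

/-- The second coordinate of a point in the basis `1`, `dir (π / 3)`. -/
noncomputable def coordB (z : ℂ) : ℝ := 2 * z.im / √3

theorem dir_re (θ : ℝ) : (dir θ).re = Real.cos θ := by
  rw [dir, Complex.exp_ofReal_mul_I_re]

theorem dir_im (θ : ℝ) : (dir θ).im = Real.sin θ := by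
  rw [dir, Complex.exp_ofReal_mul_I_im]

theorem dir_neg_pi_div_three : dir (-(Real.pi / 3)) = 1 - dir (Real.pi / 3) := by
  apply Complex.ext
  · simp only [dir_re, Complex.sub_re, Complex.one_re, Real.cos_neg, Real.cos_pi_div_three]
    norm_num
  · simp [dir_im]

theorem conj_dir_pi_div_three :
    (starRingEnd ℂ) (dir (Real.pi / 3)) = 1 - dir (Real.pi / 3) := by
  apply Complex.ext
  · simp only [Complex.conj_re, dir_re, Complex.sub_re, Complex.one_re, Real.cos_pi_div_three]
    norm_num
  · simp [dir_im]

theorem dir_mul_self : dir (Real.pi / 3) * dir (Real.pi / 3) = dir (Real.pi / 3) - 1 := by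
  have h3 : √3 * √3 = 3 := Real.mul_self_sqrt (by norm_num)
  apply Complex.ext
  · simp only [Complex.mul_re, dir_re, dir_im, Complex.sub_re, Complex.one_re,
      Real.cos_pi_div_three, Real.sin_pi_div_three]
    linarith
  · simp only [Complex.mul_im, dir_re, dir_im, Complex.sub_im, Complex.one_im,
      Real.cos_pi_div_three, Real.sin_pi_div_three]
    ring

@[simp] theorem coordA_pt (a b : ℝ) : coordA (pt a b) = a := by
  have h3 : √3 ≠ 0 := by positivity
  simp only [coordA, pt, Complex.add_re, Complex.ofReal_re, Complex.mul_re, dir_re,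
    Complex.ofReal_im, dir_im, Complex.add_im, Complex.mul_im, Real.cos_pi_div_three,
    Real.sin_pi_div_three]
  field_simp
  ring

@[simp] theorem coordB_pt (a b : ℝ) : coordB (pt a b) = b := by
  have h3 : √3 ≠ 0 := by positivity
  simp only [coordB, pt, dir_re,
    Complex.ofReal_im, dir_im, Complex.add_im, Complex.mul_im, Complex.ofReal_re,
    Real.sin_pi_div_three]
  field_simp
  ring

theorem pt_inj {a b a' b' : ℝ} : pt a b = pt a' b' ↔ a = a' ∧ b = b' := by
  constructor
  · intro h
    have h1 := congrArg coordA h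
    have h2 := congrArg coordB h
    simp only [coordA_pt, coordB_pt] at h1 h2
    exact ⟨h1, h2⟩
  · rintro ⟨rfl, rfl⟩
    rfl

theorem pt_add_mul (a b c d r : ℝ) : pt a b + (r : ℂ) * pt c d = pt (a + r * c) (b + r * d) := by
  simp only [pt]
  push_cast
  ring

theorem dir_eq_pt : dir (Real.pi / 3) = pt 0 1 := by simp [pt]

theorem normSq_pt (a b : ℝ) : Complex.normSq (pt a b) = a ^ 2 + a * b + b ^ 2 := by
  have h3 : √3 * √3 = 3 := Real.mul_self_sqrt (by norm_num)
  simp only [Complex.normSq_apply, pt, Complex.add_re, Complex.ofReal_re, Complex.mul_re, dir_re,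
    Complex.ofReal_im, dir_im, Complex.add_im, Complex.mul_im, Real.cos_pi_div_three,
    Real.sin_pi_div_three]
  linear_combination (b ^ 2 / 4) * h3

/-- The point with the coordinates `s`, `t` in the frame of the edge `e` of the lattice of mesh
`3⁻ⁿ`: the origin is the starting point of the edge, and the basis is formed by the edge and the
edge turned by `π / 3`. -/
noncomputable def frame (n : ℕ) (e : LatticeEdge) (s t : ℝ) : ℂ :=
  pt ((e.p + s * e.v - t * e.w) / 3 ^ n) ((e.q + s * e.w + t * (e.v + e.w)) / 3 ^ n)

theorem frame_first (n : ℕ) (e : LatticeEdge) (s t : ℝ) :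
    frame (n + 1) e.first s t = frame n e (s / 3) (t / 3) := by
  simp only [frame, LatticeEdge.first, pt_inj, pow_succ]
  push_cast
  constructor <;> field_simp

theorem frame_middle (n : ℕ) (e : LatticeEdge) (s t : ℝ) :
    frame (n + 1) e.middle s t = frame n e ((1 + s) / 3) (t / 3) := by
  simp only [frame, LatticeEdge.middle, pt_inj]
  push_cast
  constructor <;> field_simp <;> ring

theorem frame_last (n : ℕ) (e : LatticeEdge) (s t : ℝ) :
    frame (n + 1) e.last s t = frame n e ((2 + s) / 3) (t / 3) := by
  simp only [frame, LatticeEdge.last, pt_inj]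
  push_cast
  constructor <;> field_simp <;> ring

theorem frame_toApex (n : ℕ) (e : LatticeEdge) (s t : ℝ) :
    frame (n + 1) e.toApex s t = frame n e ((1 + s + t) / 3) (-s / 3) := by
  simp only [frame, LatticeEdge.toApex, pt_inj]
  push_cast
  constructor <;> field_simp <;> ring

theorem frame_fromApex (n : ℕ) (e : LatticeEdge) (s t : ℝ) :
    frame (n + 1) e.fromApex s t = frame n e ((2 - t) / 3) ((s + t - 1) / 3) := by
  simp only [frame, LatticeEdge.fromApex, pt_inj]
  push_cast
  constructor <;> field_simp <;> ring

theorem oneThird_frame (n : ℕ) (e : LatticeEdge) :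
    oneThird (frame n e 0 0) (frame n e 1 0) = frame n e (1 / 3) 0 := by
  simp only [oneThird, frame, pt]
  push_cast
  ring

theorem twoThird_frame (n : ℕ) (e : LatticeEdge) :
    twoThird (frame n e 0 0) (frame n e 1 0) = frame n e (2 / 3) 0 := by
  simp only [twoThird, frame, pt]
  push_cast
  ring

theorem apex_frame (n : ℕ) (e : LatticeEdge) :
    apex (frame n e 0 0) (frame n e 1 0) = frame n e (2 / 3) (-(1 / 3)) := by
  simp only [apex, oneThird, frame, pt, dir_neg_pi_div_three]
  push_cast
  linear_combination (-(e.w : ℂ) / 3 / 3 ^ n) * dir_mul_self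

theorem mem_sides_iff {n : ℕ} {s : ℂ × ℂ} :
    s ∈ sides n ↔ ∃ e, IsSide n e ∧ s = (frame n e 0 0, frame n e 1 0) := by
  induction n generalizing s with
  | zero =>
    simp only [sides, List.mem_cons, List.not_mem_nil, or_false, IsSide, exists_eq_or_imp,
      exists_eq_left, frame, pt]
    norm_num
  | succ n ih =>
    simp only [sides, List.mem_flatMap, List.mem_cons, List.not_mem_nil, or_false]
    constructor
    · rintro ⟨r, hr, h⟩
      obtain ⟨e, he, rfl⟩ := ih.1 hr
      simp only [oneThird_frame, twoThird_frame, apex_frame] at h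
      rcases h with rfl | rfl | rfl | rfl
      · exact ⟨_, he.first, by simp [frame_first]⟩
      · exact ⟨_, he.toApex, by simp [frame_toApex]; norm_num⟩
      · exact ⟨_, he.fromApex, by simp [frame_fromApex]; norm_num⟩
      · exact ⟨_, he.last, by simp [frame_last]; norm_num⟩
    · rintro ⟨e, ⟨f, hf, h⟩, rfl⟩
      refine ⟨_, ih.2 ⟨f, hf, rfl⟩, ?_⟩
      simp only [oneThird_frame, twoThird_frame, apex_frame]
      rcases h with rfl | rfl | rfl | rfl
      · exact Or.inl (by simp [frame_first])
      · exact Or.inr (Or.inl (by simp [frame_toApex]; norm_num))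
      · exact Or.inr (Or.inr (Or.inl (by simp [frame_fromApex]; norm_num)))
      · exact Or.inr (Or.inr (Or.inr (by simp [frame_last]; norm_num)))

theorem frame_combo (n : ℕ) (e : LatticeEdge) (s t s' t' : ℝ) {a b : ℝ} (h : a + b = 1) :
    a • frame n e s t + b • frame n e s' t' =
      frame n e (a * s + b * s') (a * t + b * t') := by
  obtain rfl : a = 1 - b := by linarith
  simp only [frame, pt, Complex.real_smul]
  push_cast
  ring

theorem mem_openSegment_frame {n : ℕ} {e : LatticeEdge} {z : ℂ} :
    z ∈ openSegment ℝ (frame n e 0 0) (frame n e 1 0) ↔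
      ∃ u : ℝ, 0 < u ∧ u < 1 ∧ z = frame n e u 0 := by
  constructor
  · rintro ⟨a, b, ha, hb, hab, rfl⟩
    exact ⟨b, hb, by linarith, by rw [frame_combo n e _ _ _ _ hab]; simp⟩
  · rintro ⟨u, h0, h1, rfl⟩
    exact ⟨1 - u, u, by linarith, h0, by ring, by rw [frame_combo n e _ _ _ _ (by ring)]; simp⟩

theorem mem_segment_frame {n : ℕ} {e : LatticeEdge} {z : ℂ} :
    z ∈ segment ℝ (frame n e 0 0) (frame n e 1 0) ↔
      ∃ u : ℝ, 0 ≤ u ∧ u ≤ 1 ∧ z = frame n e u 0 := by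
  constructor
  · rintro ⟨a, b, ha, hb, hab, rfl⟩
    exact ⟨b, hb, by linarith, by rw [frame_combo n e _ _ _ _ hab]; simp⟩
  · rintro ⟨u, h0, h1, rfl⟩
    exact ⟨1 - u, u, by linarith, h0, by ring, by rw [frame_combo n e _ _ _ _ (by ring)]; simp⟩

theorem mem_KS_iff {n : ℕ} {z : ℂ} :
    z ∈ KS n ↔ ∃ e, IsSide n e ∧ ∃ u : ℝ, 0 ≤ u ∧ u ≤ 1 ∧ z = frame n e u 0 := by
  constructor
  · rintro ⟨s, hs, hz⟩
    obtain ⟨e, he, rfl⟩ := mem_sides_iff.1 hs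
    exact ⟨e, he, mem_segment_frame.1 hz⟩
  · rintro ⟨e, he, hz⟩
    exact ⟨_, mem_sides_iff.2 ⟨e, he, rfl⟩, mem_segment_frame.2 hz⟩

/-! ### Safe points and the location of points in lattice triangles. -/

/-- The point `z` lies on none of the closed lattice triangles which touch the table `Ω(KS_n)` from
outside along a side. -/
def Safe (n : ℕ) (z : ℂ) : Prop :=
  ∀ f, IsSide n f → ∀ s t : ℝ, t ≤ 0 → s ≤ 1 → 0 ≤ s + t → z ≠ frame n f s t

/-- The closed triangle outside each new side is contained in the closed triangle outside its
parent. Hence safety, unlike mere avoidance of `KS n`, is inherited by all finer levels. -/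
theorem Safe.succ {n : ℕ} {z : ℂ} (h : Safe n z) : Safe (n + 1) z := by
  rintro e ⟨f, hf, rfl | rfl | rfl | rfl⟩ s t ht hs hst
  · rw [frame_first]
    exact h f hf _ _ (by linarith) (by linarith) (by linarith)
  · rw [frame_toApex]
    exact h f hf _ _ (by linarith) (by linarith) (by linarith)
  · rw [frame_fromApex]
    exact h f hf _ _ (by linarith) (by linarith) (by linarith)
  · rw [frame_last]
    exact h f hf _ _ (by linarith) (by linarith) (by linarith)

theorem Safe.notMem_KS {n : ℕ} {z : ℂ} (h : Safe n z) : z ∉ KS n := by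
  rw [mem_KS_iff]
  rintro ⟨e, he, u, h0, h1, rfl⟩
  exact h e he u 0 le_rfl h1 (by simpa using h0) rfl

/-- The closed lattice triangle of mesh `3⁻ⁿ` with the given lower bounds of coordinates. -/
def closedTriangle (n : ℕ) (τ : ℤ × ℤ × ℤ) : Set ℂ :=
  {z | τ.1 ≤ 3 ^ n * coordA z ∧ 3 ^ n * coordA z ≤ τ.1 + 1 ∧
    τ.2.1 ≤ 3 ^ n * coordB z ∧ 3 ^ n * coordB z ≤ τ.2.1 + 1 ∧
    τ.2.2 ≤ 3 ^ n * (coordA z + coordB z) ∧ 3 ^ n * (coordA z + coordB z) ≤ τ.2.2 + 1}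

/-- The open lattice triangle of mesh `3⁻ⁿ` with the given lower bounds of coordinates. -/
def openTriangle (n : ℕ) (τ : ℤ × ℤ × ℤ) : Set ℂ :=
  {z | τ.1 < 3 ^ n * coordA z ∧ 3 ^ n * coordA z < τ.1 + 1 ∧
    τ.2.1 < 3 ^ n * coordB z ∧ 3 ^ n * coordB z < τ.2.1 + 1 ∧
    τ.2.2 < 3 ^ n * (coordA z + coordB z) ∧ 3 ^ n * (coordA z + coordB z) < τ.2.2 + 1}

theorem coordA_frame (n : ℕ) (e : LatticeEdge) (s t : ℝ) :
    3 ^ n * coordA (frame n e s t) = e.p + s * e.v - t * e.w := by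
  rw [frame, coordA_pt]
  field_simp

theorem coordB_frame (n : ℕ) (e : LatticeEdge) (s t : ℝ) :
    3 ^ n * coordB (frame n e s t) = e.q + s * e.w + t * (e.v + e.w) := by
  rw [frame, coordB_pt]
  field_simp

theorem frame_mem_openTriangle_left {n : ℕ} {e : LatticeEdge} (he : e.HasUnitStep) {s t : ℝ}
    (hs : 0 < s) (ht : 0 < t) (hst : s + t < 1) : frame n e s t ∈ openTriangle n e.left := by
  obtain ⟨p, q, v, w⟩ := e
  simp only [openTriangle, Set.mem_ofPred_eq, mul_add, coordA_frame, coordB_frame, left]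
  simp only [HasUnitStep] at he
  rcases he with ⟨rfl, rfl⟩ | ⟨rfl, rfl⟩ | ⟨rfl, rfl⟩ | ⟨rfl, rfl⟩ | ⟨rfl, rfl⟩ | ⟨rfl, rfl⟩ <;>
    norm_num <;> refine ⟨?_, ?_, ?_, ?_, ?_, ?_⟩ <;> linarith

theorem frame_mem_closedTriangle_right {n : ℕ} {e : LatticeEdge} (he : e.HasUnitStep) {s t : ℝ}
    (ht : t ≤ 0) (hs : s ≤ 1) (hst : 0 ≤ s + t) : frame n e s t ∈ closedTriangle n e.right := by
  obtain ⟨p, q, v, w⟩ := e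
  simp only [closedTriangle, Set.mem_ofPred_eq, mul_add, coordA_frame, coordB_frame, right]
  simp only [HasUnitStep] at he
  rcases he with ⟨rfl, rfl⟩ | ⟨rfl, rfl⟩ | ⟨rfl, rfl⟩ | ⟨rfl, rfl⟩ | ⟨rfl, rfl⟩ | ⟨rfl, rfl⟩ <;>
    norm_num <;> refine ⟨?_, ?_, ?_, ?_, ?_, ?_⟩ <;> linarith

theorem int_eq_of_open_of_closed {i j : ℤ} {a : ℝ} (h1 : (i : ℝ) < a) (h2 : a < i + 1)
    (h3 : (j : ℝ) ≤ a) (h4 : a ≤ j + 1) : i = j := by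
  have h5 : i < j + 1 := by exact_mod_cast h1.trans_le h4
  have h6 : j < i + 1 := by exact_mod_cast h3.trans_lt h2
  omega

theorem eq_of_mem_openTriangle {n : ℕ} {τ τ' : ℤ × ℤ × ℤ} {z : ℂ} (h : z ∈ openTriangle n τ)
    (h' : z ∈ closedTriangle n τ') : τ = τ' := by
  obtain ⟨h1, h2, h3, h4, h5, h6⟩ := h
  obtain ⟨g1, g2, g3, g4, g5, g6⟩ := h'
  exact Prod.ext (int_eq_of_open_of_closed h1 h2 g1 g2)
    (Prod.ext (int_eq_of_open_of_closed h3 h4 g3 g4) (int_eq_of_open_of_closed h5 h6 g5 g6))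

/-- The only lattice triangles containing an inner point of an edge are the two adjacent ones. -/
theorem eq_left_or_right_of_mem {n : ℕ} {e : LatticeEdge} (he : e.HasUnitStep) {s : ℝ}
    (hs : 0 < s) (hs1 : s < 1) {f : LatticeEdge} (hf : f.HasUnitStep)
    (h : frame n e s 0 ∈ closedTriangle n f.right) :
    f.right = e.left ∨ f.right = e.right := by
  obtain ⟨p, q, v, w⟩ := e
  -- A triple is a genuine triangle only in these two cases. Two of its entries are pinned below by
  -- the position of the point; this relation leaves two values for the third, one for each side of
  -- the edge.
  have hτ : f.right.2.2 = f.right.1 + f.right.2.1 ∨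
      f.right.2.2 = f.right.1 + f.right.2.1 + 1 := by
    simp only [HasUnitStep] at hf
    simp only [right]
    omega
  generalize f.right = τ at *
  obtain ⟨i, j, k⟩ := τ
  simp only [closedTriangle, Set.mem_ofPred_eq, mul_add, coordA_frame, coordB_frame] at h
  simp only [HasUnitStep] at he
  simp only [left, right, Prod.mk.injEq] at hτ ⊢
  obtain ⟨h1, h2, h3, h4, h5, h6⟩ := h
  rcases he with ⟨rfl, rfl⟩ | ⟨rfl, rfl⟩ | ⟨rfl, rfl⟩ | ⟨rfl, rfl⟩ | ⟨rfl, rfl⟩ | ⟨rfl, rfl⟩ <;>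
    norm_num at h1 h2 h3 h4 h5 h6 ⊢
  · have a1 : i < p + 1 := by exact_mod_cast (by linarith : (i : ℝ) < p + 1)
    have a2 : p < i + 1 := by exact_mod_cast (by linarith : (p : ℝ) < i + 1)
    have a3 : k < p + q + 1 := by exact_mod_cast (by linarith : (k : ℝ) < p + q + 1)
    have a4 : p + q < k + 1 := by exact_mod_cast (by linarith : (p : ℝ) + q < k + 1)
    omega
  · have a1 : j < q + 1 := by exact_mod_cast (by linarith : (j : ℝ) < q + 1)
    have a2 : q < j + 1 := by exact_mod_cast (by linarith : (q : ℝ) < j + 1)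
    have a3 : k < p + q + 1 := by exact_mod_cast (by linarith : (k : ℝ) < p + q + 1)
    have a4 : p + q < k + 1 := by exact_mod_cast (by linarith : (p : ℝ) + q < k + 1)
    omega
  · have a1 : j < q + 1 := by exact_mod_cast (by linarith : (j : ℝ) < q + 1)
    have a2 : q < j + 1 := by exact_mod_cast (by linarith : (q : ℝ) < j + 1)
    have a3 : i < p := by exact_mod_cast (by linarith : (i : ℝ) < p)
    have a4 : p < i + 2 := by exact_mod_cast (by linarith : (p : ℝ) < i + 2)
    omega
  · have a1 : i < p := by exact_mod_cast (by linarith : (i : ℝ) < p)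
    have a2 : p < i + 2 := by exact_mod_cast (by linarith : (p : ℝ) < i + 2)
    have a3 : k < p + q := by exact_mod_cast (by linarith : (k : ℝ) < p + q)
    have a4 : p + q < k + 2 := by exact_mod_cast (by linarith : (p : ℝ) + q < k + 2)
    omega
  · have a1 : j < q := by exact_mod_cast (by linarith : (j : ℝ) < q)
    have a2 : q < j + 2 := by exact_mod_cast (by linarith : (q : ℝ) < j + 2)
    have a3 : k < p + q := by exact_mod_cast (by linarith : (k : ℝ) < p + q)
    have a4 : p + q < k + 2 := by exact_mod_cast (by linarith : (p : ℝ) + q < k + 2)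
    omega
  · have a1 : j < q := by exact_mod_cast (by linarith : (j : ℝ) < q)
    have a2 : q < j + 2 := by exact_mod_cast (by linarith : (q : ℝ) < j + 2)
    have a3 : i < p + 1 := by exact_mod_cast (by linarith : (i : ℝ) < p + 1)
    have a4 : p < i + 1 := by exact_mod_cast (by linarith : (p : ℝ) < i + 1)
    omega

theorem safe_of_left {n : ℕ} {e : LatticeEdge} (he : IsSide n e) {s t : ℝ}
    (hs : 0 < s) (ht : 0 < t) (hst : s + t < 1) : Safe n (frame n e s t) := by
  intro f hf s' t' ht' hs' hst' h
  have h1 := frame_mem_openTriangle_left (n := n) he.hasUnitStep hs ht hst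
  have h2 := frame_mem_closedTriangle_right (n := n) hf.hasUnitStep ht' hs' hst'
  rw [← h] at h2
  exact hf.right_not_inTable (eq_of_mem_openTriangle h1 h2 ▸ he.left_inTable)

theorem safe_of_inTable_inTable {n : ℕ} {e : LatticeEdge} (he : e.HasUnitStep)
    (hl : InTable n e.left) (hr : InTable n e.right) {s : ℝ} (hs : 0 < s) (hs1 : s < 1) :
    Safe n (frame n e s 0) := by
  intro f hf s' t' ht' hs' hst' h
  have h2 := frame_mem_closedTriangle_right (n := n) hf.hasUnitStep ht' hs' hst'
  rw [← h] at h2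
  rcases eq_left_or_right_of_mem he hs hs1 hf.hasUnitStep h2 with h3 | h3
  · exact hf.right_not_inTable (h3 ▸ hl)
  · exact hf.right_not_inTable (h3 ▸ hr)

/-- The cell of a side, with the open middle third of the side but without the other two sides, is
safe on the next level. -/
theorem safe_cell {n : ℕ} {e : LatticeEdge} (he : IsSide n e) {s t : ℝ}
    (ht : t ≤ 0) (hst : 1 / 3 < s + t) (hs : s < 2 / 3) : Safe (n + 1) (frame n e s t) := by
  rcases ht.lt_or_eq with ht | rfl
  -- These parameters invert `frame_toApex`.
  · have := safe_of_left he.toApex (s := -3 * t) (t := 3 * s - 1 + 3 * t)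
      (by linarith) (by linarith) (by linarith)
    rw [frame_toApex] at this
    convert this using 2 <;> ring
  -- On the open middle third both neighbours, the old triangle and the cell, belong to the next
  -- table.
  · have hu := he.hasUnitStep
    have := safe_of_inTable_inTable (n := n + 1) (e := e.middle) (s := 3 * s - 1)
      hu (Or.inl (by rw [coarse_left_middle hu]; exact he.left_inTable))
      (Or.inr ⟨e, he, right_middle hu⟩) (by linarith) (by linarith)
    rw [frame_middle] at this
    convert this using 2 <;> ring

/-- Two sides that share an inner point are equal. -/
theorem IsSide.eq_of_frame_eq {n : ℕ} {e f : LatticeEdge} (he : IsSide n e) (hf : IsSide n f)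
    {s s' : ℝ} (hs : 0 < s) (hs1 : s < 1) (hs' : 0 < s') (hs1' : s' < 1)
    (h : frame n e s 0 = frame n f s' 0) : e = f ∧ s = s' := by
  have hr : f.right = e.right := by
    have h2 := frame_mem_closedTriangle_right (n := n) hf.hasUnitStep le_rfl hs1'.le
      (by linarith : 0 ≤ s' + 0)
    rw [← h] at h2
    rcases eq_left_or_right_of_mem he.hasUnitStep hs hs1 hf.hasUnitStep h2 with h3 | h3
    · exact absurd (h3 ▸ he.left_inTable) hf.right_not_inTable
    · exact h3
  have hA := congrArg (fun z => 3 ^ n * coordA z) h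
  have hB := congrArg (fun z => 3 ^ n * coordB z) h
  simp only [coordA_frame, coordB_frame] at hA hB
  have hu := he.hasUnitStep
  have hu' := hf.hasUnitStep
  clear he hf h
  obtain ⟨p, q, v, w⟩ := e
  obtain ⟨p', q', v', w'⟩ := f
  simp only [HasUnitStep] at hu hu'
  simp only [right, Prod.mk.injEq] at hr
  simp only [LatticeEdge.mk.injEq]
  rcases hu with ⟨rfl, rfl⟩ | ⟨rfl, rfl⟩ | ⟨rfl, rfl⟩ | ⟨rfl, rfl⟩ | ⟨rfl, rfl⟩ | ⟨rfl, rfl⟩ <;>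
  rcases hu' with ⟨rfl, rfl⟩ | ⟨rfl, rfl⟩ | ⟨rfl, rfl⟩ | ⟨rfl, rfl⟩ | ⟨rfl, rfl⟩ | ⟨rfl, rfl⟩ <;>
  norm_num at hr hA hB ⊢ <;>
  first
  | omega
  | exact ⟨⟨by omega, by omega⟩, by
      obtain ⟨r1, r2, r3⟩ := hr
      have c1 := congrArg (Int.cast : ℤ → ℝ) r1
      have c2 := congrArg (Int.cast : ℤ → ℝ) r2
      linarith⟩
  | exfalso
    obtain ⟨r1, r2, r3⟩ := hr
    have c1 := congrArg (Int.cast : ℤ → ℝ) r1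
    have c2 := congrArg (Int.cast : ℤ → ℝ) r2
    have c3 := congrArg (Int.cast : ℤ → ℝ) r3
    push_cast at c1 c2 c3
    linarith

/-! ### Chords: beams of parallel flights between two sides, and their refinement. -/

/-- The billiard ball leaving the edge `e` at any inner point `u`, at the angle `π / 3` with `e`,
travels safely until it arrives at the point `1 - u` of the edge `e'`, after the time `B - u`
in the unit `3⁻ⁿ`. -/
structure Chord (n : ℕ) (B : ℝ) (e e' : LatticeEdge) : Prop where
  v_eq : e'.v = -e.v - e.w
  w_eq : e'.w = e.v
  pos : ∀ u : ℝ, 0 < u → u < 1 → 0 < B - u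
  arrive : ∀ u : ℝ, 0 < u → u < 1 → frame n e u (B - u) = frame n e' (1 - u) 0
  safe : ∀ u : ℝ, 0 < u → u < 1 → ∀ t : ℝ, 0 < t → t < B - u → Safe n (frame n e u t)

theorem Chord.frame_eq {n : ℕ} {B : ℝ} {e e' : LatticeEdge} (h : Chord n B e e') {u : ℝ}
    (h0 : 0 < u) (h1 : u < 1) (r : ℝ) :
    frame n e u (B - u + r) = frame n e' (1 - u + r) (-r) := by
  have h2 := h.arrive u h0 h1
  simp only [frame, pt_inj, h.v_eq, h.w_eq] at h2 ⊢
  push_cast at h2 ⊢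
  constructor
  · linear_combination h2.1
  · linear_combination h2.2

/-- The point u of the first third is the point u/3 of `e`, and 1 - u/3 = (2 + (1 - u))/3 lies in
the last third of `e'`; the time B - u/3 is 3B - u in the finer unit. -/
theorem Chord.first_last {n : ℕ} {B : ℝ} {e e' : LatticeEdge} (h : Chord n B e e') :
    Chord (n + 1) (3 * B) e.first e'.last where
  v_eq := h.v_eq
  w_eq := h.w_eq
  pos u h0 h1 := by linarith [h.pos (u / 3) (by linarith) (by linarith)]
  arrive u h0 h1 := by
    have := h.arrive (u / 3) (by linarith) (by linarith)
    rw [frame_first, frame_last]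
    convert this using 2 <;> ring
  safe u h0 h1 t ht ht1 := by
    rw [frame_first]
    exact (h.safe (u / 3) (by linarith) (by linarith) _ (by linarith) (by linarith)).succ

theorem Chord.last_first {n : ℕ} {B : ℝ} {e e' : LatticeEdge} (h : Chord n B e e') :
    Chord (n + 1) (3 * B - 2) e.last e'.first where
  v_eq := h.v_eq
  w_eq := h.w_eq
  pos u h0 h1 := by linarith [h.pos ((2 + u) / 3) (by linarith) (by linarith)]
  arrive u h0 h1 := by
    have := h.arrive ((2 + u) / 3) (by linarith) (by linarith)
    rw [frame_first, frame_last]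
    convert this using 2 <;> ring
  safe u h0 h1 t ht ht1 := by
    rw [frame_last]
    exact (h.safe ((2 + u) / 3) (by linarith) (by linarith) _ (by linarith) (by linarith)).succ

/-- A line through the middle thirds continues into both cells, by (1 - u)/3 at each end. It crosses
`e` at (2 - u)/3, so its length is B - (2 - u)/3 + 2(1 - u)/3 = B - u/3. In the cells the roles of
the angles π/3 and 2π/3 are exchanged, so the new chord runs from `e'` to `e`. -/
theorem Chord.fromApex_toApex {n : ℕ} {B : ℝ} {e e' : LatticeEdge} (h : Chord n B e e')
    (he : IsSide n e) (he' : IsSide n e') : Chord (n + 1) (3 * B) e'.fromApex e.toApex where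
  v_eq := by
    have h1 := h.v_eq
    have h2 := h.w_eq
    simp only [LatticeEdge.fromApex, LatticeEdge.toApex]
    omega
  w_eq := by
    have h2 := h.w_eq
    simp only [LatticeEdge.fromApex, LatticeEdge.toApex]
    omega
  pos u h0 h1 := by linarith [h.pos ((2 - u) / 3) (by linarith) (by linarith)]
  arrive u h0 h1 := by
    have := h.frame_eq (u := (2 - u) / 3) (by linarith) (by linarith) (1 / 3 - B)
    rw [frame_fromApex, frame_toApex]
    convert this.symm using 2 <;> ring
  safe u h0 h1 t ht ht1 := by
    have h2 := h.frame_eq (u := (2 - u) / 3) (by linarith) (by linarith) ((1 - u - t) / 3)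
    have h3 : frame (n + 1) e'.fromApex u t =
        frame n e' (1 - (2 - u) / 3 + (1 - u - t) / 3) (-((1 - u - t) / 3)) := by
      rw [frame_fromApex]
      congr 1 <;> ring
    -- The quantity (1 - u - t)/3 is the signed distance left until `e'` is crossed. The point is in
    -- the cell of `e'`, in the cell of `e`, or on the old chord.
    rcases le_or_gt 0 (1 - u - t) with hr | hr
    · rw [h3]
      exact safe_cell he' (by linarith) (by linarith) (by linarith)
    · rw [h3, ← h2]
      rcases le_or_gt (B - (2 - u) / 3 + (1 - u - t) / 3) 0 with hB | hB
      · exact safe_cell he hB (by linarith) (by linarith)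
      · exact (h.safe ((2 - u) / 3) (by linarith) (by linarith) _ hB (by linarith)).succ

theorem chord_toApex_fromApex {n : ℕ} {e : LatticeEdge} (he : IsSide n e) :
    Chord (n + 1) 1 e.toApex e.fromApex where
  v_eq := by simp only [LatticeEdge.fromApex, LatticeEdge.toApex]; omega
  w_eq := by simp only [LatticeEdge.fromApex, LatticeEdge.toApex]
  pos u h0 h1 := by linarith
  arrive u h0 h1 := by
    rw [frame_fromApex, frame_toApex]
    congr 1 <;> ring
  safe u h0 h1 t ht ht1 := safe_of_left he.toApex h0 ht (by linarith)

/-! ### Directions, reflections and the billiard step along a chord. -/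

/-- The direction in which the ball leaves the edge `e`, at the angle `π / 3` (for `c = true`) or
`2 * π / 3` (for `c = false`) with the edge. -/
noncomputable def outDir (c : Bool) (e : LatticeEdge) : ℂ :=
  bif c then pt (-e.w) (e.v + e.w) else pt (-(e.v + e.w)) e.v

theorem norm_outDir (c : Bool) {e : LatticeEdge} (he : e.HasUnitStep) : ‖outDir c e‖ = 1 := by
  have : Complex.normSq (outDir c e) = 1 := by
    obtain ⟨p, q, v, w⟩ := e
    simp only [HasUnitStep] at he
    cases c <;> simp only [outDir, cond_true, cond_false, normSq_pt] <;>
    rcases he with ⟨rfl, rfl⟩ | ⟨rfl, rfl⟩ | ⟨rfl, rfl⟩ | ⟨rfl, rfl⟩ | ⟨rfl, rfl⟩ | ⟨rfl, rfl⟩ <;>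
    norm_num
  rw [Complex.normSq_eq_norm_sq] at this
  nlinarith [norm_nonneg (outDir c e)]

/-- Relative to `a` as unit, the reflection in the line of `a` is complex conjugation. -/
theorem reflection_span_singleton_mul (a z : ℂ) (ha : a ≠ 0) :
    (Submodule.span ℝ {a}).reflection (a * z) = a * (starRingEnd ℂ) z := by
  have h1 : inner ℝ a (a * z) = ‖a‖ ^ 2 * z.re := by
    rw [Complex.inner, mul_right_comm, Complex.mul_conj,
      Complex.re_ofReal_mul, Complex.normSq_eq_norm_sq]
  have h2 : (‖a‖ : ℝ) ^ 2 ≠ 0 := by simpa using ha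
  rw [Submodule.reflection_singleton_apply, h1]
  have h3 : ‖a‖ ^ 2 * z.re / (‖a‖ : ℝ) ^ 2 = z.re := by field_simp
  have h4 : (starRingEnd ℂ) z = 2 * (z.re : ℂ) - z := by
    apply Complex.ext <;> simp
    ring
  rw [h4]
  simp only [RCLike.ofReal_real_eq_id, id]
  rw [h3, Complex.real_smul, two_smul]
  ring

theorem frame_sub_frame (n : ℕ) (e : LatticeEdge) :
    frame n e 1 0 - frame n e 0 0 = ((e.v : ℂ) + e.w * dir (Real.pi / 3)) / 3 ^ n := by
  simp only [frame, pt]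
  push_cast
  ring

theorem frame_sub_frame_ne_zero (n : ℕ) {e : LatticeEdge} (he : e.HasUnitStep) :
    frame n e 1 0 - frame n e 0 0 ≠ 0 := by
  rw [sub_ne_zero]
  intro h
  have hA := congrArg (fun z => 3 ^ n * coordA z) h
  have hB := congrArg (fun z => 3 ^ n * coordB z) h
  simp only [coordA_frame, coordB_frame, zero_mul, one_mul, add_zero, sub_zero, add_eq_left,
    Int.cast_eq_zero] at hA hB
  unfold HasUnitStep at he
  omega

theorem reflection_outDir (c : Bool) {n : ℕ} {e e' : LatticeEdge} (he' : e'.HasUnitStep)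
    (h : bif c then e'.v = -e.v - e.w ∧ e'.w = e.v else e.v = -e'.v - e'.w ∧ e.w = e'.v) :
    (Submodule.span ℝ {frame n e' 1 0 - frame n e' 0 0}).reflection (outDir c e) =
      outDir c e' := by
  have h0 := frame_sub_frame_ne_zero n he'
  have h3 : (3 : ℂ) ^ n ≠ 0 := pow_ne_zero _ (by norm_num)
  have hD := dir_mul_self
  cases c
  · obtain ⟨hv, hw⟩ := h
    have h1 : outDir false e =
        (frame n e' 1 0 - frame n e' 0 0) * (-(3 ^ n * dir (Real.pi / 3))) := by
      rw [frame_sub_frame]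
      simp only [outDir, cond_false, pt, hv, hw]
      push_cast
      field_simp
      linear_combination (e'.w : ℂ) * hD
    rw [h1, reflection_span_singleton_mul _ _ h0, frame_sub_frame]
    simp only [map_neg, map_mul, map_pow, Complex.conj_ofNat, conj_dir_pi_div_three, outDir,
      cond_false, pt]
    push_cast
    field_simp
    linear_combination (e'.w : ℂ) * hD
  · obtain ⟨hv, hw⟩ := h
    have hw' : e.w = -e'.v - e'.w := by omega
    have h1 : outDir true e =
        (frame n e' 1 0 - frame n e' 0 0) * (3 ^ n * (1 - dir (Real.pi / 3))) := by
      rw [frame_sub_frame]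
      simp only [outDir, cond_true, pt, hw', ← hw]
      push_cast
      field_simp
      linear_combination (e'.w : ℂ) * hD
    rw [h1, reflection_span_singleton_mul _ _ h0, frame_sub_frame]
    simp only [map_sub, map_one, map_mul, map_pow, Complex.conj_ofNat, conj_dir_pi_div_three,
      outDir, cond_true, pt]
    push_cast
    field_simp
    linear_combination (e'.w : ℂ) * hD

/-- The first hitting time must be `T`: safety excludes an earlier hit, and the point reached at `T`
lies on the curve. As this is an inner point of a side, the reflecting side is unique. -/
theorem BilliardStep.eq_of_safe {n : ℕ} {p q : ℂ × ℂ} (hq : BilliardStep n p q) {T : ℝ}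
    (hT : 0 < T) {e' : LatticeEdge} (he' : IsSide n e') {u : ℝ} (h0 : 0 < u) (h1 : u < 1)
    (harr : p.1 + (T : ℂ) * p.2 = frame n e' u 0)
    (hsafe : ∀ r : ℝ, 0 < r → r < T → Safe n (p.1 + (r : ℂ) * p.2)) :
    q.1 = frame n e' u 0 ∧
      q.2 = (Submodule.span ℝ {frame n e' 1 0 - frame n e' 0 0}).reflection p.2 := by
  obtain ⟨t, ht, hq1, hfree, s, hs, hqs, hq2⟩ := hq
  obtain ⟨f, hf, rfl⟩ := mem_sides_iff.1 hs
  obtain ⟨u', h0', h1', hqf⟩ := mem_openSegment_frame.1 hqs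
  have hqKS : q.1 ∈ KS n := mem_KS_iff.2 ⟨f, hf, u', h0'.le, h1'.le, hqf⟩
  have htT : t = T := by
    rcases lt_trichotomy t T with h | h | h
    · exact absurd (hq1 ▸ hqKS) (hsafe t ht h).notMem_KS
    · exact h
    · exact absurd (mem_KS_iff.2 ⟨e', he', u, h0.le, h1.le, harr⟩) (hfree T hT h)
  subst htT
  have hq1' : q.1 = frame n e' u 0 := hq1.trans harr
  obtain ⟨rfl, -⟩ := hf.eq_of_frame_eq he' h0' h1' h0 h1 (hqf.symm.trans hq1')
  exact ⟨hq1', hq2⟩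

theorem frame_add_outDir_true (n : ℕ) (e : LatticeEdge) (s t r : ℝ) :
    frame n e s t + (r : ℂ) * outDir true e = frame n e s (t + 3 ^ n * r) := by
  simp only [frame, outDir, cond_true, pt_add_mul, pt_inj]
  constructor <;> field_simp <;> ring

theorem frame_add_outDir_false (n : ℕ) (e : LatticeEdge) (s t r : ℝ) :
    frame n e s t + (r : ℂ) * outDir false e = frame n e (s - 3 ^ n * r) (t + 3 ^ n * r) := by
  simp only [frame, outDir, cond_false, pt_add_mul, pt_inj]
  constructor <;> field_simp <;> ring

/-- A chord from `e` to `e'`, or, if `c` is false, the reverse of a chord from `e'` to `e`. -/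
def DirChord (n : ℕ) (c : Bool) (B : ℝ) (e e' : LatticeEdge) : Prop :=
  bif c then Chord n B e e' else Chord n B e' e

/-- The time that the ball needs for a directed chord when it leaves the first edge at the point
`u`. -/
noncomputable def flightTime (n : ℕ) (c : Bool) (B u : ℝ) : ℝ :=
  (B - bif c then u else 1 - u) / 3 ^ n

theorem DirChord.flight {n : ℕ} {c : Bool} {B : ℝ} {e e' : LatticeEdge}
    (h : DirChord n c B e e') {u : ℝ} (h0 : 0 < u) (h1 : u < 1) :
    0 < flightTime n c B u ∧
    frame n e u 0 + (flightTime n c B u : ℂ) * outDir c e = frame n e' (1 - u) 0 ∧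
    ∀ r : ℝ, 0 < r → r < flightTime n c B u → Safe n (frame n e u 0 + (r : ℂ) * outDir c e) := by
  have h3 : (0 : ℝ) < 3 ^ n := by positivity
  cases c
  · simp only [DirChord, cond_false] at h
    simp only [flightTime, cond_false, frame_add_outDir_false]
    refine ⟨div_pos (h.pos (1 - u) (by linarith) (by linarith)) h3, ?_, fun r hr hr1 => ?_⟩
    · have := h.frame_eq (u := 1 - u) (by linarith) (by linarith) (-(B - (1 - u)))
      rw [mul_div_cancel₀ _ h3.ne']
      convert this.symm using 2 <;> ring
    · rw [lt_div_iff₀ h3] at hr1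
      have := h.frame_eq (u := 1 - u) (by linarith) (by linarith) (-(3 ^ n * r))
      have h5 : frame n e (u - 3 ^ n * r) (0 + 3 ^ n * r) =
          frame n e' (1 - u) (B - (1 - u) + -(3 ^ n * r)) := by
        rw [this]
        congr 1 <;> ring
      rw [h5]
      exact h.safe _ (by linarith) (by linarith) _ (by linarith) (by nlinarith)
  · simp only [DirChord, cond_true] at h
    simp only [flightTime, cond_true, frame_add_outDir_true]
    refine ⟨div_pos (h.pos u h0 h1) h3, ?_, fun r hr hr1 => ?_⟩
    · rw [mul_div_cancel₀ _ h3.ne', zero_add]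
      exact h.arrive u h0 h1
    · rw [lt_div_iff₀ h3] at hr1
      exact h.safe u h0 h1 _ (by positivity) (by linarith)

theorem DirChord.billiardStep_eq {n : ℕ} {c : Bool} {B : ℝ} {e e' : LatticeEdge}
    (h : DirChord n c B e e') (he' : IsSide n e') {u : ℝ} (h0 : 0 < u) (h1 : u < 1)
    {q : ℂ × ℂ} (hq : BilliardStep n (frame n e u 0, outDir c e) q) :
    q = (frame n e' (1 - u) 0, outDir c e') := by
  obtain ⟨hT, harr, hsafe⟩ := h.flight h0 h1
  obtain ⟨hq1, hq2⟩ := hq.eq_of_safe hT he' (by linarith : 0 < 1 - u) (by linarith) harr hsafe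
  refine Prod.ext hq1 (hq2.trans ?_)
  apply reflection_outDir c he'.hasUnitStep
  cases c
  · exact ⟨Chord.v_eq h, Chord.w_eq h⟩
  · exact ⟨Chord.v_eq h, Chord.w_eq h⟩

theorem DirChord.dist_eq {n : ℕ} {c : Bool} {B : ℝ} {e e' : LatticeEdge}
    (h : DirChord n c B e e') (he : IsSide n e) {u : ℝ} (h0 : 0 < u) (h1 : u < 1) :
    dist (frame n e u 0) (frame n e' (1 - u) 0) = flightTime n c B u := by
  obtain ⟨hT, harr, -⟩ := h.flight h0 h1
  rw [← harr, dist_self_add_right, norm_mul, norm_outDir c he.hasUnitStep, mul_one,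
    Complex.norm_real, Real.norm_of_nonneg hT.le]

/-! ### Itineraries, periods and lengths. -/

/-- The sequence of sides `σ` of `KS_n`, of period `N`, is the itinerary of the ball, whose `j`-th
flight is described by a directed chord with the constant `B j`. -/
structure IsItinerary (n : ℕ) (c : Bool) (σ : ℕ → LatticeEdge) (B : ℕ → ℝ) (N : ℕ) : Prop where
  side : ∀ j, IsSide n (σ j)
  chord : ∀ j, DirChord n c (B j) (σ j) (σ (j + 1))
  eq_iff : ∀ i j, σ i = σ j ↔ i ≡ j [MOD N]

/-- The sequence `u, 1 - u, u, 1 - u, …`. -/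
noncomputable def altCoord (u : ℝ) (j : ℕ) : ℝ := bif j.bodd then 1 - u else u

theorem altCoord_succ (u : ℝ) (j : ℕ) : altCoord u (j + 1) = 1 - altCoord u j := by
  simp only [altCoord, Nat.bodd_succ]
  cases j.bodd <;> simp

theorem altCoord_pos {u : ℝ} (h0 : 0 < u) (h1 : u < 1) (j : ℕ) : 0 < altCoord u j := by
  simp only [altCoord]
  cases j.bodd <;> simp <;> linarith

theorem altCoord_lt_one {u : ℝ} (h0 : 0 < u) (h1 : u < 1) (j : ℕ) : altCoord u j < 1 := by
  simp only [altCoord]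
  cases j.bodd <;> simp <;> linarith

theorem bodd_eq_false_iff (j : ℕ) : j.bodd = false ↔ 2 ∣ j := by
  have := Nat.mod_two_of_bodd j
  cases h : j.bodd <;> simp [h] at this ⊢ <;> omega

theorem bodd_eq_bodd_iff (i j : ℕ) : i.bodd = j.bodd ↔ i ≡ j [MOD 2] := by
  have h1 := Nat.mod_two_of_bodd i
  have h2 := Nat.mod_two_of_bodd j
  unfold Nat.ModEq
  rw [h1, h2]
  cases i.bodd <;> cases j.bodd <;> simp

theorem altCoord_eq_iff (u : ℝ) (j : ℕ) : altCoord u j = u ↔ 2 ∣ j ∨ u = 1 / 2 := by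
  rw [← bodd_eq_false_iff]
  simp only [altCoord]
  cases j.bodd
  · simp
  · simp only [cond_true, Bool.true_eq_false, false_or]
    constructor <;> intro h <;> linarith

theorem sum_altCoord (u : ℝ) (M : ℕ) : ∑ j ∈ Finset.range (2 * M), altCoord u j = M := by
  induction M with
  | zero => simp
  | succ M ih =>
    rw [show 2 * (M + 1) = 2 * M + 1 + 1 by ring, Finset.sum_range_succ, Finset.sum_range_succ, ih,
      altCoord_succ]
    push_cast
    ring

section Orbit

variable {n : ℕ} {c : Bool} {σ : ℕ → LatticeEdge} {B : ℕ → ℝ} {N : ℕ} {u : ℝ} {q : ℕ → ℂ × ℂ}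

theorem IsItinerary.orbit_eq (h : IsItinerary n c σ B N) (h0 : 0 < u) (h1 : u < 1)
    (hq0 : q 0 = (frame n (σ 0) u 0, outDir c (σ 0)))
    (hq : ∀ k, BilliardStep n (q k) (q (k + 1))) (j : ℕ) :
    q j = (frame n (σ j) (altCoord u j) 0, outDir c (σ j)) := by
  induction j with
  | zero => simpa [altCoord] using hq0
  | succ j ih =>
    have := hq j
    rw [ih] at this
    rw [(h.chord j).billiardStep_eq (h.side _) (altCoord_pos h0 h1 j) (altCoord_lt_one h0 h1 j)
      this, altCoord_succ]

/-- The side recurs with period N and the parameter with period 2, except that u = 1 - u at the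
midpoint; the side determines the direction. -/
theorem IsItinerary.state_eq_iff (h : IsItinerary n c σ B N) (h0 : 0 < u) (h1 : u < 1)
    (hq0 : q 0 = (frame n (σ 0) u 0, outDir c (σ 0)))
    (hq : ∀ k, BilliardStep n (q k) (q (k + 1))) (j : ℕ) :
    q j = q 0 ↔ N ∣ j ∧ (2 ∣ j ∨ u = 1 / 2) := by
  rw [h.orbit_eq h0 h1 hq0 hq j, hq0, ← altCoord_eq_iff, ← Nat.modEq_zero_iff_dvd, ← h.eq_iff]
  constructor
  · intro he
    exact (h.side j).eq_of_frame_eq (h.side 0) (altCoord_pos h0 h1 j) (altCoord_lt_one h0 h1 j)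
      h0 h1 (congrArg Prod.fst he)
  · rintro ⟨h2, h3⟩
    rw [h2, h3]

theorem IsItinerary.period_eq (h : IsItinerary n c σ B N) (h0 : 0 < u) (h1 : u < 1)
    (hq0 : q 0 = (frame n (σ 0) u 0, outDir c (σ 0)))
    (hq : ∀ k, BilliardStep n (q k) (q (k + 1))) {M : ℕ} (hM : 0 < M)
    (hMN : ∀ k, (N ∣ k ∧ (2 ∣ k ∨ u = 1 / 2)) ↔ M ∣ k) : period q = M := by
  have hset : {k | 0 < k ∧ q k = q 0} = {k | 0 < k ∧ M ∣ k} := by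
    ext k
    simp only [Set.mem_ofPred_eq, h.state_eq_iff h0 h1 hq0 hq, hMN]
  rw [period, hset]
  have hmem : M ∈ {k | 0 < k ∧ M ∣ k} := ⟨hM, dvd_rfl⟩
  apply le_antisymm (Nat.sInf_le hmem)
  obtain ⟨h2, h3⟩ := Nat.sInf_mem ⟨M, hmem⟩
  exact Nat.le_of_dvd h2 h3

theorem IsItinerary.pathLength_eq (h : IsItinerary n c σ B N) (h0 : 0 < u) (h1 : u < 1)
    (hq0 : q 0 = (frame n (σ 0) u 0, outDir c (σ 0)))
    (hq : ∀ k, BilliardStep n (q k) (q (k + 1))) :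
    pathLength q = ∑ j ∈ Finset.range (period q), flightTime n c (B j) (altCoord u j) := by
  refine Finset.sum_congr rfl fun j _ => ?_
  rw [h.orbit_eq h0 h1 hq0 hq j, h.orbit_eq h0 h1 hq0 hq (j + 1), altCoord_succ]
  exact (h.chord j).dist_eq (h.side j) (altCoord_pos h0 h1 j) (altCoord_lt_one h0 h1 j)

theorem IsItinerary.period_eq_of_even (h : IsItinerary n c σ B N) (h0 : 0 < u) (h1 : u < 1)
    (hq0 : q 0 = (frame n (σ 0) u 0, outDir c (σ 0)))
    (hq : ∀ k, BilliardStep n (q k) (q (k + 1))) (hN : 0 < N) (hN2 : 2 ∣ N) : period q = N :=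
  h.period_eq h0 h1 hq0 hq hN fun _ => ⟨fun hk => hk.1, fun hk => ⟨hk, Or.inl (hN2.trans hk)⟩⟩

theorem IsItinerary.pathLength_eq_of_even (h : IsItinerary n c σ B N) (h0 : 0 < u) (h1 : u < 1)
    (hq0 : q 0 = (frame n (σ 0) u 0, outDir c (σ 0)))
    (hq : ∀ k, BilliardStep n (q k) (q (k + 1))) (hN : 0 < N) (hN2 : 2 ∣ N) :
    pathLength q = (∑ j ∈ Finset.range N, B j - N / 2) / 3 ^ n := by
  rw [h.pathLength_eq h0 h1 hq0 hq, h.period_eq_of_even h0 h1 hq0 hq hN hN2]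
  obtain ⟨M, rfl⟩ := hN2
  -- Each consecutive pair of flights contributes u + (1 - u) = 1, so the total does not depend on
  -- u.
  have hs : ∑ j ∈ Finset.range (2 * M), (bif c then altCoord u j else 1 - altCoord u j) = M := by
    cases c
    · simp only [cond_false]
      rw [Finset.sum_sub_distrib, sum_altCoord]
      simp
      ring
    · simpa using sum_altCoord u M
  simp only [flightTime]
  rw [← Finset.sum_div, Finset.sum_sub_distrib, hs]
  push_cast
  congr 1
  ring

end Orbit

/-! ### Refinement of itineraries to the next level. -/

/-- The last or the first third of an edge. -/
def LatticeEdge.third (b : Bool) (e : LatticeEdge) : LatticeEdge := bif b then e.last else e.first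

/-- One of the two free sides of the cell of an edge. -/
def LatticeEdge.cellSide (b : Bool) (e : LatticeEdge) : LatticeEdge :=
  bif b then e.toApex else e.fromApex

theorem IsSide.third {n : ℕ} {e : LatticeEdge} (h : IsSide n e) (b : Bool) :
    IsSide (n + 1) (e.third b) := by
  cases b
  exacts [h.first, h.last]

theorem IsSide.cellSide {n : ℕ} {e : LatticeEdge} (h : IsSide n e) (b : Bool) :
    IsSide (n + 1) (e.cellSide b) := by
  cases b
  exacts [h.fromApex, h.toApex]

theorem third_eq_iff {b b' : Bool} {e f : LatticeEdge} (he : e.HasUnitStep) :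
    e.third b = f.third b' ↔ e = f ∧ b = b' := by
  obtain ⟨p, q, v, w⟩ := e
  obtain ⟨p', q', v', w'⟩ := f
  simp only [HasUnitStep] at he
  cases b <;> cases b' <;>
  simp [LatticeEdge.third, LatticeEdge.first, LatticeEdge.last] <;> omega

theorem cellSide_eq_iff {b b' : Bool} {e f : LatticeEdge} (he : e.HasUnitStep)
    (hf : f.HasUnitStep) : e.cellSide b = f.cellSide b' ↔ e = f ∧ b = b' := by
  obtain ⟨p, q, v, w⟩ := e
  obtain ⟨p', q', v', w'⟩ := f
  simp only [HasUnitStep] at he hf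
  cases b <;> cases b' <;>
  simp [LatticeEdge.cellSide, LatticeEdge.toApex, LatticeEdge.fromApex] <;> omega

theorem sum_bool_alternating (b : Bool) (M : ℕ) :
    ∑ j ∈ Finset.range (2 * M), (bif b ^^ j.bodd then (2 : ℝ) else 0) = 2 * M := by
  induction M with
  | zero => simp
  | succ M ih =>
    rw [show 2 * (M + 1) = 2 * M + 1 + 1 by ring, Finset.sum_range_succ, Finset.sum_range_succ, ih,
      Nat.bodd_succ]
    push_cast
    cases b <;> cases (2 * M).bodd <;> simp <;> ring

/-- If the ball always hits the outer thirds of the sides, the itinerary on the next level goes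
through outer thirds. -/
theorem IsItinerary.third {n : ℕ} {c : Bool} {σ : ℕ → LatticeEdge} {B : ℕ → ℝ} {N : ℕ}
    (h : IsItinerary n c σ B N) (b : Bool) :
    IsItinerary (n + 1) c (fun j => (σ j).third (b ^^ j.bodd))
      (fun j => 3 * B j - bif ((b ^^ !c) ^^ j.bodd) then 2 else 0) (N.lcm 2) where
  side j := (h.side j).third _
  -- For `c = false` the flight reverses a chord issuing from `σ (j + 1)`, which is hit in the
  -- opposite third to `σ j`; hence the negation of `c` in the constant.
  chord j := by
    have := h.chord j
    simp only [Nat.bodd_succ]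
    cases c
    · cases b <;> cases j.bodd <;> simp only [LatticeEdge.third, DirChord] at this ⊢
      · simpa using Chord.last_first this
      · simpa using Chord.first_last this
      · simpa using Chord.first_last this
      · simpa using Chord.last_first this
    · cases b <;> cases j.bodd <;> simp only [LatticeEdge.third, DirChord] at this ⊢
      · simpa using Chord.first_last this
      · simpa using Chord.last_first this
      · simpa using Chord.last_first this
      · simpa using Chord.first_last this
  eq_iff i j := by
    -- Side and third recur together modulo the lcm of N and 2, which differs from N only for odd N.
    rw [third_eq_iff (h.side i).hasUnitStep, h.eq_iff, Bool.xor_right_inj, bodd_eq_bodd_iff,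
      ← Int.natCast_modEq_iff, ← Int.natCast_modEq_iff, ← Int.natCast_modEq_iff,
      Int.modEq_and_modEq_iff_modEq_lcm]
    rfl

theorem add_one_div_two_modEq_iff (i j N : ℕ) :
    ((i + 1) / 2 ≡ (j + 1) / 2 [MOD N] ∧ i.bodd = j.bodd) ↔ i ≡ j [MOD 2 * N] := by
  rw [bodd_eq_bodd_iff]
  rcases Nat.even_or_odd' i with ⟨a, rfl | rfl⟩ <;> rcases Nat.even_or_odd' j with ⟨b, rfl | rfl⟩
  · rw [show (2 * a + 1) / 2 = a by omega, show (2 * b + 1) / 2 = b by omega,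
      Nat.ModEq.mul_left_cancel_iff' two_ne_zero]
    simp [Nat.ModEq]
  · refine ⟨fun h => absurd h.2 ?_, fun h => absurd (h.of_mul_right N) ?_⟩ <;>
    simp [Nat.ModEq]
  · refine ⟨fun h => absurd h.2 ?_, fun h => absurd (h.of_mul_right N) ?_⟩ <;>
    simp [Nat.ModEq]
  · rw [show (2 * a + 1 + 1) / 2 = a + 1 by omega, show (2 * b + 1 + 1) / 2 = b + 1 by omega,
      ← Nat.ModEq.mul_left_cancel_iff' (m := N) two_ne_zero]
    refine ⟨fun h => ?_, fun h => ⟨?_, by simp [Nat.ModEq]⟩⟩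
    · exact Nat.ModEq.add_right_cancel' 1 h.1
    · exact Nat.ModEq.add_right 1 h

/-- If the ball always hits the middle thirds of the sides, the itinerary on the next level goes
through the free sides of the cells. -/
theorem IsItinerary.cellSide {n : ℕ} {c : Bool} {σ : ℕ → LatticeEdge} {B : ℕ → ℝ} {N : ℕ}
    (h : IsItinerary n c σ B N) :
    IsItinerary (n + 1) (!c) (fun k => (σ ((k + 1) / 2)).cellSide (c ^^ k.bodd))
      (fun k => bif k.bodd then 1 else 3 * B (k / 2)) (2 * N) where
  side j := (h.side _).cellSide _
  -- The flight 2j goes from the cell of `σ j` to the cell of `σ (j + 1)`, and the flight 2j + 1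
  -- stays in the latter; the cycle begins on the exit side of the cell of `σ 0`.
  chord k := by
    rcases Nat.even_or_odd' k with ⟨j, rfl | rfl⟩
    · have := h.chord j
      rw [show (2 * j + 1) / 2 = j by omega, show (2 * j + 1 + 1) / 2 = j + 1 by omega,
        show 2 * j / 2 = j by omega]
      simp only [Nat.bodd_succ, (bodd_eq_false_iff (2 * j)).2 ⟨j, rfl⟩]
      cases c
      · simpa [LatticeEdge.cellSide, DirChord] using
          Chord.fromApex_toApex this (h.side _) (h.side _)
      · simpa [LatticeEdge.cellSide, DirChord] using
          Chord.fromApex_toApex this (h.side _) (h.side _)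
    · rw [show (2 * j + 1 + 1) / 2 = j + 1 by omega, show (2 * j + 1 + 1 + 1) / 2 = j + 1 by omega]
      simp only [Nat.bodd_succ, (bodd_eq_false_iff (2 * j)).2 ⟨j, rfl⟩]
      have := chord_toApex_fromApex (h.side (j + 1))
      cases c <;> simpa [LatticeEdge.cellSide, DirChord] using this
  eq_iff i j := by
    rw [cellSide_eq_iff (h.side _).hasUnitStep (h.side _).hasUnitStep, h.eq_iff,
      Bool.xor_right_inj, add_one_div_two_modEq_iff]

theorem sum_cellSide (B : ℕ → ℝ) (N : ℕ) :
    ∑ k ∈ Finset.range (2 * N), (bif k.bodd then 1 else 3 * B (k / 2)) =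
      3 * ∑ j ∈ Finset.range N, B j + N := by
  induction N with
  | zero => simp
  | succ N ih =>
    rw [show 2 * (N + 1) = 2 * N + 1 + 1 by ring, Finset.sum_range_succ, Finset.sum_range_succ, ih,
      Finset.sum_range_succ, Nat.bodd_succ, (bodd_eq_false_iff (2 * N)).2 ⟨N, rfl⟩,
      show 2 * N / 2 = N by omega]
    push_cast
    simp
    ring

theorem sum_third (B : ℕ → ℝ) (b : Bool) (N : ℕ) (hN : 2 ∣ N) :
    ∑ j ∈ Finset.range N, (3 * B j - bif b ^^ j.bodd then 2 else 0) =
      3 * ∑ j ∈ Finset.range N, B j - N := by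
  obtain ⟨M, rfl⟩ := hN
  rw [Finset.sum_sub_distrib, sum_bool_alternating, Finset.mul_sum]
  push_cast
  ring

/-- The itinerary in the equilateral triangle. -/
def triangleItinerary (j : ℕ) : LatticeEdge :=
  if j % 3 = 0 then ⟨0, 0, 1, 0⟩ else if j % 3 = 1 then ⟨1, 0, -1, 1⟩ else ⟨0, 1, 0, -1⟩

theorem triangleItinerary_isItinerary :
    IsItinerary 0 true triangleItinerary (fun _ => 1) 3 where
  side j := by
    unfold triangleItinerary
    split_ifs <;> simp [IsSide]
  chord j := by
    have hside : IsSide 0 (triangleItinerary j) := by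
      unfold triangleItinerary
      split_ifs <;> simp [IsSide]
    refine (?_ : Chord 0 1 _ _)
    refine ⟨?_, ?_, fun u _ h1 => by linarith, fun u _ _ => ?_,
      fun u h0 _ t h1 h2 => safe_of_left hside h0 h1 (by linarith)⟩
    all_goals
      have hj : j % 3 < 3 := Nat.mod_lt _ (by norm_num)
      unfold triangleItinerary
      rw [Nat.add_mod]
      interval_cases j % 3 <;> norm_num [frame, pt_inj] <;> ring
  eq_iff i j := by
    have hi : i % 3 < 3 := Nat.mod_lt _ (by norm_num)
    have hj : j % 3 < 3 := Nat.mod_lt _ (by norm_num)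
    unfold triangleItinerary Nat.ModEq
    interval_cases i % 3 <;> interval_cases j % 3 <;> simp

/-! ### From the geometric table to lattice triangles; inward directions. -/

theorem coordA_add (z w : ℂ) : coordA (z + w) = coordA z + coordA w := by
  simp only [coordA, Complex.add_re, Complex.add_im]
  ring

theorem coordB_add (z w : ℂ) : coordB (z + w) = coordB z + coordB w := by
  simp only [coordB, Complex.add_im]
  ring

theorem coordA_smul (r : ℝ) (z : ℂ) : coordA (r • z) = r * coordA z := by
  simp only [coordA, Complex.smul_re, Complex.smul_im, smul_eq_mul]
  ring

theorem coordB_smul (r : ℝ) (z : ℂ) : coordB (r • z) = r * coordB z := by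
  simp only [coordB, Complex.smul_im, smul_eq_mul]
  ring

theorem convex_closedTriangle (n : ℕ) (τ : ℤ × ℤ × ℤ) : Convex ℝ (closedTriangle n τ) := by
  rintro x ⟨h1, h2, h3, h4, h5, h6⟩ y ⟨g1, g2, g3, g4, g5, g6⟩ a b ha hb hab
  obtain rfl : a = 1 - b := by linarith
  simp only [closedTriangle, Set.mem_ofPred_eq, coordA_add, coordB_add, coordA_smul, coordB_smul]
  generalize coordA x = xa at *
  generalize coordB x = xb at *
  generalize coordA y = ya at *
  generalize coordB y = yb at *
  refine ⟨?_, ?_, ?_, ?_, ?_, ?_⟩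
  · linear_combination (1 - b) * h1 + b * g1
  · linear_combination (1 - b) * h2 + b * g2
  · linear_combination (1 - b) * h3 + b * g3
  · linear_combination (1 - b) * h4 + b * g4
  · linear_combination (1 - b) * h5 + b * g5
  · linear_combination (1 - b) * h6 + b * g6

theorem frame_mem_closedTriangle_left {n : ℕ} {e : LatticeEdge} (he : e.HasUnitStep) {s t : ℝ}
    (hs : 0 ≤ s) (ht : 0 ≤ t) (hst : s + t ≤ 1) : frame n e s t ∈ closedTriangle n e.left := by
  obtain ⟨p, q, v, w⟩ := e
  simp only [closedTriangle, Set.mem_ofPred_eq, mul_add, coordA_frame, coordB_frame, left]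
  simp only [HasUnitStep] at he
  rcases he with ⟨rfl, rfl⟩ | ⟨rfl, rfl⟩ | ⟨rfl, rfl⟩ | ⟨rfl, rfl⟩ | ⟨rfl, rfl⟩ | ⟨rfl, rfl⟩ <;>
    norm_num <;> refine ⟨?_, ?_, ?_, ?_, ?_, ?_⟩ <;> linarith

theorem exists_fine_bound {i : ℤ} {a : ℝ} (h1 : i ≤ a) (h2 : a ≤ i + 1) :
    ∃ j : ℤ, j / 3 = i ∧ j ≤ 3 * a ∧ 3 * a ≤ j + 1 := by
  -- The cap matters only for a = i + 1, where the floor would leave the coarse interval.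
  refine ⟨min ⌊3 * a⌋ (3 * i + 2), ?_, ?_, ?_⟩
  · have : 3 * i ≤ ⌊3 * a⌋ := Int.le_floor.2 (by push_cast; linarith)
    omega
  · exact (Int.cast_le.2 (min_le_left _ _)).trans (Int.floor_le _)
  · rcases min_choice ⌊3 * a⌋ (3 * i + 2) with h | h <;> rw [h]
    · exact (Int.lt_floor_add_one _).le
    · push_cast
      linarith

theorem exists_closedTriangle_of_mem_table {n : ℕ} {z : ℂ} (hz : z ∈ table n) :
    ∃ τ, InTable n τ ∧ z ∈ closedTriangle n τ := by
  induction n with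
  | zero =>
    refine ⟨(0, 0, 0), rfl, ?_⟩
    refine convexHull_min ?_ (convex_closedTriangle _ _) hz
    have h0 : (0 : ℂ) = pt 0 0 := by simp [pt]
    have h1 : (1 : ℂ) = pt 1 0 := by simp [pt]
    rw [dir_eq_pt, h0, h1]
    rintro w (rfl | rfl | rfl) <;> simp [closedTriangle]
  | succ n ih =>
    rcases hz with hz | hz
    · obtain ⟨⟨i, j, k⟩, hτ, h1, h2, h3, h4, h5, h6⟩ := ih hz
      obtain ⟨i', hi, hi1, hi2⟩ := exists_fine_bound h1 h2
      obtain ⟨j', hj, hj1, hj2⟩ := exists_fine_bound h3 h4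
      obtain ⟨k', hk, hk1, hk2⟩ := exists_fine_bound h5 h6
      refine ⟨(i', j', k'), Or.inl ?_, ?_⟩
      · simpa only [coarse, hi, hj, hk] using hτ
      · simp only [closedTriangle, Set.mem_ofPred_eq, pow_succ]
        refine ⟨?_, ?_, ?_, ?_, ?_, ?_⟩ <;> linarith
    · simp only [Set.mem_iUnion] at hz
      obtain ⟨s, hs, hz⟩ := hz
      obtain ⟨e, he, rfl⟩ := mem_sides_iff.1 hs
      refine ⟨e.toApex.left, Or.inr ⟨e, he, rfl⟩, ?_⟩
      refine convexHull_min ?_ (convex_closedTriangle _ _) hz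
      have hu := he.toApex.hasUnitStep
      simp only [oneThird_frame, apex_frame, twoThird_frame]
      rintro w (rfl | rfl | rfl)
      · convert frame_mem_closedTriangle_left (n := n + 1) hu le_rfl le_rfl (by norm_num) using 1
        rw [frame_toApex]
        congr 1 <;> ring
      · convert frame_mem_closedTriangle_left (n := n + 1) hu zero_le_one le_rfl (by norm_num)
          using 1
        rw [frame_toApex]
        congr 1 <;> ring
      · convert frame_mem_closedTriangle_left (n := n + 1) hu le_rfl zero_le_one (by norm_num)
          using 1
        rw [frame_toApex]
        congr 1 <;> ring

theorem pt_add_dir (a b r : ℝ) : pt a b + (r : ℂ) * dir (Real.pi / 3) = pt a (b + r) := by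
  rw [dir_eq_pt, pt_add_mul]
  simp

/-- Moving slightly in the direction π/3 keeps the first coordinate and the three floors while
leaving all lattice lines, so the ball enters the open triangle given by these floors. -/
theorem inTable_of_pointsInward {n : ℕ} {x b : ℝ} (hx : ∀ k : ℤ, 3 ^ n * x ≠ k)
    (h : PointsInward n (pt x b) (dir (Real.pi / 3))) :
    InTable n (⌊3 ^ n * x⌋, ⌊3 ^ n * b⌋, ⌊3 ^ n * (x + b)⌋) := by
  have h3 : (0 : ℝ) < 3 ^ n := by positivity
  have g1 := Int.lt_floor_add_one (3 ^ n * b)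
  have g2 := Int.lt_floor_add_one (3 ^ n * (x + b))
  have e1 : ∀ᶠ t : ℝ in 𝓝[>] 0, 3 ^ n * t < ⌊3 ^ n * b⌋ + 1 - 3 ^ n * b := by
    apply Filter.Eventually.filter_mono nhdsWithin_le_nhds
    exact ContinuousAt.eventually_lt (by fun_prop) continuousAt_const (by linarith)
  have e2 : ∀ᶠ t : ℝ in 𝓝[>] 0, 3 ^ n * t < ⌊3 ^ n * (x + b)⌋ + 1 - 3 ^ n * (x + b) := by
    apply Filter.Eventually.filter_mono nhdsWithin_le_nhds
    exact ContinuousAt.eventually_lt (by fun_prop) continuousAt_const (by linarith)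
  have e3 : ∀ᶠ t : ℝ in 𝓝[>] 0, 0 < t := eventually_mem_nhdsWithin
  obtain ⟨t, ht1, ht2, ht3, ht4⟩ := (e1.and (e2.and (e3.and h.2))).exists
  have hz := interior_subset ht4
  rw [pt_add_dir] at hz
  obtain ⟨τ, hτ, hzτ⟩ := exists_closedTriangle_of_mem_table hz
  have hzo : pt x (b + t) ∈ openTriangle n
      (⌊3 ^ n * x⌋, ⌊3 ^ n * b⌋, ⌊3 ^ n * (x + b)⌋) := by
    simp only [openTriangle, Set.mem_ofPred_eq, coordA_pt, coordB_pt]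
    have f1 := Int.floor_le (3 ^ n * b)
    have f2 := Int.floor_le (3 ^ n * (x + b))
    have f3 := mul_pos h3 ht3
    refine ⟨lt_of_le_of_ne (Int.floor_le _) (hx _).symm, Int.lt_floor_add_one _, ?_, ?_, ?_, ?_⟩ <;>
      linarith
  rw [eq_of_mem_openTriangle hzo hzτ]
  exact hτ

/-- An inner point of a side has an integral first coordinate only if the side is parallel to the
direction π/3. The ball would then slide along the side and stay on the curve for a short time. -/
theorem ne_int_of_billiardStep {n : ℕ} {x b : ℝ} (h : PointsInward n (pt x b) (dir (Real.pi / 3)))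
    {q : ℂ × ℂ} (hq : BilliardStep n (pt x b, dir (Real.pi / 3)) q) (k : ℤ) : 3 ^ n * x ≠ k := by
  intro hk
  obtain ⟨⟨s, hs, hz⟩, -⟩ := h
  obtain ⟨e, he, rfl⟩ := mem_sides_iff.1 hs
  obtain ⟨u, h0, h1, hu⟩ := mem_openSegment_frame.1 hz
  obtain ⟨T, hT, -, hfree, -⟩ := hq
  have hA := congrArg (fun z => 3 ^ n * coordA z) hu
  have hB := congrArg (fun z => 3 ^ n * coordB z) hu
  simp only [coordA_frame, coordB_frame, coordA_pt, coordB_pt, hk] at hA hB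
  have hv : e.v = 0 ∧ (e.w = 1 ∨ e.w = -1) := by
    have hstep := he.hasUnitStep
    unfold HasUnitStep at hstep
    have hcases : e.v = 0 ∨ e.v = 1 ∨ e.v = -1 := by omega
    rcases hcases with hv | hv | hv
    · omega
    · exfalso
      rw [hv] at hA
      push_cast at hA
      have a1 : e.p < k := by exact_mod_cast (by linarith : (e.p : ℝ) < k)
      have a2 : k < e.p + 1 := by exact_mod_cast (by linarith : (k : ℝ) < e.p + 1)
      omega
    · exfalso
      rw [hv] at hA
      push_cast at hA
      have a1 : k < e.p := by exact_mod_cast (by linarith : (k : ℝ) < e.p)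
      have a2 : e.p < k + 1 := by exact_mod_cast (by linarith : (e.p : ℝ) < k + 1)
      omega
  have h3 : (0 : ℝ) < 3 ^ n := by positivity
  have hw : (e.w : ℝ) * e.w = 1 ∧ |(e.w : ℝ)| ≤ 1 := by
    rcases hv.2 with hw | hw <;> rw [hw] <;> norm_num
  obtain ⟨hw1, hw2⟩ := abs_le.1 hw.2
  -- Small enough to precede the next collision and to remain on the side.
  set r := min (T / 2) (min u (1 - u) / 3 ^ n) with hr
  have hm : 0 < min u (1 - u) := lt_min h0 (by linarith)
  have hr0 : 0 < r := lt_min (by linarith) (div_pos hm h3)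
  have hrT : r < T := (min_le_left _ _).trans_lt (by linarith)
  have hr1 : 3 ^ n * r ≤ min u (1 - u) := by
    have := min_le_right (T / 2) (min u (1 - u) / 3 ^ n)
    rw [← hr, le_div_iff₀ h3] at this
    linarith
  have hr2 := hr1.trans (min_le_left _ _)
  have hr3 := hr1.trans (min_le_right _ _)
  have hr4 : 0 < 3 ^ n * r := by positivity
  refine hfree r hr0 hrT (mem_KS_iff.2 ⟨e, he, u + 3 ^ n * r * e.w, ?_, ?_, ?_⟩)
  · nlinarith
  · nlinarith
  · simp only [hu, dir_eq_pt, frame, pt_add_mul, pt_inj, hv.1]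
    push_cast
    constructor
    · field_simp
      ring
    · field_simp
      linear_combination (-3 ^ n * r) * hw.1

/-! ### Ternary digits: `d m` selects the third hit in passing from level m to m + 1. -/

theorem ofDigits_eq_head_add_tail (d : ℕ → Fin 3) :
    3 * Real.ofDigits d = ((d 0 : ℕ) : ℝ) + Real.ofDigits (fun i => d (i + 1)) := by
  have := Real.ofDigits_eq_sum_add_ofDigits d 1
  rw [this]
  simp [Real.ofDigitsTerm]
  ring

theorem exists_int_add_ofDigits (d : ℕ → Fin 3) (m : ℕ) :
    ∃ K : ℤ, 3 ^ m * Real.ofDigits d = K + Real.ofDigits (fun i => d (i + m)) := by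
  induction m with
  | zero => exact ⟨0, by simp⟩
  | succ m ih =>
    obtain ⟨K, hK⟩ := ih
    refine ⟨3 * K + (d m : ℕ), ?_⟩
    have := ofDigits_eq_head_add_tail (fun i => d (i + m))
    simp only [zero_add, add_right_comm _ 1 m] at this
    rw [pow_succ, mul_right_comm, hK]
    push_cast
    simp only [← add_assoc]
    linarith

theorem fract_eq_ofDigits {d : ℕ → Fin 3} {m : ℕ}
    (h : ∀ k : ℤ, 3 ^ m * Real.ofDigits d ≠ k) :
    Int.fract (3 ^ m * Real.ofDigits d) = Real.ofDigits (fun i => d (i + m)) := by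
  obtain ⟨K, hK⟩ := exists_int_add_ofDigits d m
  rw [Int.fract_eq_iff]
  refine ⟨Real.ofDigits_nonneg _, lt_of_le_of_ne (Real.ofDigits_le_one _) fun h1 => ?_, K, ?_⟩
  · rw [h1] at hK
    exact h (K + 1) (by push_cast; exact hK)
  · linarith

theorem three_mul_fract_eq {d : ℕ → Fin 3} {x : ℝ} (hd : x = Real.ofDigits d) (m : ℕ)
    (h : ∀ m, ∀ k : ℤ, 3 ^ m * x ≠ k) :
    3 * Int.fract (3 ^ m * x) = ((d m : ℕ) : ℝ) + Int.fract (3 ^ (m + 1) * x) := by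
  subst hd
  rw [fract_eq_ofDigits (h m), fract_eq_ofDigits (h (m + 1)), ofDigits_eq_head_add_tail]
  simp only [zero_add, add_assoc, add_comm 1 m]

theorem floor_pow_succ_eq {d : ℕ → Fin 3} {x : ℝ} (hd : x = Real.ofDigits d) (m : ℕ)
    (h : ∀ m, ∀ k : ℤ, 3 ^ m * x ≠ k) :
    ⌊3 ^ (m + 1) * x⌋ = 3 * ⌊3 ^ m * x⌋ + (d m : ℕ) := by
  have h1 := three_mul_fract_eq hd m h
  have h2 := Int.floor_add_fract (3 ^ m * x)
  have h3 := Int.floor_add_fract (3 ^ (m + 1) * x)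
  have h4 : (3 : ℝ) ^ (m + 1) * x = 3 * (3 ^ m * x) := by ring
  have : ((⌊3 ^ (m + 1) * x⌋ : ℤ) : ℝ) = ((3 * ⌊3 ^ m * x⌋ + (d m : ℕ) : ℤ) : ℝ) := by
    push_cast
    linarith
  exact_mod_cast this

/-! ### The initial base point on each level. -/

/-- On the way up in a column of the lattice, from a triangle of the table to a triangle outside,
one meets the curve `KS_n`. -/
theorem exists_mem_KS_of_inTable {n : ℕ} {x b : ℝ} (hx : ∀ k : ℤ, 3 ^ n * x ≠ k) (hb : b < 0)
    (hT : InTable n (⌊3 ^ n * x⌋, ⌊3 ^ n * b⌋, ⌊3 ^ n * (x + b)⌋))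
    (hout : ¬ InTable n (⌊3 ^ n * x⌋, -1, ⌊3 ^ n * x⌋)) :
    ∃ b' : ℝ, b < b' ∧ b' < 0 ∧ pt x b' ∈ KS n := by
  have h3 : (0 : ℝ) < 3 ^ n := by positivity
  have hx' := hx ⌊3 ^ n * x⌋
  rw [mul_add] at hT
  have hB : 3 ^ n * b < 0 := mul_neg_of_pos_of_neg h3 hb
  set A := 3 ^ n * x with hA
  set D := 3 ^ n * b with hD
  have hA1 := Int.lt_floor_add_one A
  have hA0 : (⌊A⌋ : ℝ) < A := lt_of_le_of_ne (Int.floor_le A) hx'.symm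
  have hD0 := Int.floor_le D
  have hD1 := Int.lt_floor_add_one D
  have hS0 := Int.floor_le (A + D)
  have hS1 := Int.lt_floor_add_one (A + D)
  set i := ⌊A⌋
  set l := ⌊D⌋
  set k := ⌊A + D⌋
  have c1 : k < i + l + 2 := by exact_mod_cast (by linarith : (k : ℝ) < i + l + 2)
  have c2 : i + l < k + 1 := by exact_mod_cast (by linarith : (i : ℝ) + l < k + 1)
  have c3 : l < 0 := by exact_mod_cast (by linarith : (l : ℝ) < 0)
  have c4 : k < i + 1 := by exact_mod_cast (by linarith : (k : ℝ) < i + 1)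
  -- The index s numbers the triangles of the column upwards, even s for those with k = i + j and
  -- odd s for those with k = i + j + 1. The given triangle has s = l + k - i, and s = -1 is the one
  -- just below the base line. Some step leaves the table, and the edge crossed there is a side.
  obtain ⟨s, hs1, hs2, hs3, hs4⟩ : ∃ s : ℤ, l + k - i ≤ s ∧ s < -1 ∧
      InTable n (i, s / 2, i + (s + 1) / 2) ∧
      ¬ InTable n (i, (s + 1) / 2, i + (s + 1 + 1) / 2) := by
    by_contra hcon
    push Not at hcon
    have hall : ∀ s : ℤ, l + k - i ≤ s → s ≤ -1 → InTable n (i, s / 2, i + (s + 1) / 2) := by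
      intro s hs
      induction s, hs using Int.leInduction with
      | base =>
        intro _
        convert hT using 3 <;> omega
      | succ s hs ih =>
        intro h
        exact hcon s hs (by omega) (ih (by omega))
    have := hall (-1) (by omega) le_rfl
    exact hout (by simpa using this)
  obtain ⟨j, rfl | rfl⟩ := Int.even_or_odd' s
  · rw [show 2 * j / 2 = j by omega, show (2 * j + 1) / 2 = j by omega] at hs3
    rw [show (2 * j + 1 + 1) / 2 = j + 1 by omega, show (2 * j + 1) / 2 = j by omega] at hs4
    have hside : IsSide n ⟨i + 1, j, -1, 1⟩ := by
      apply isSide_of_left_right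
      · simp [HasUnitStep]
      · convert hs3 using 1
        simp [left]
        ring
      · convert hs4 using 1
        simp [right]
        ring_nf
    refine ⟨((i : ℝ) + j + 1 - A) / 3 ^ n, ?_, ?_, mem_KS_iff.2 ⟨_, hside, i + 1 - A, ?_, ?_, ?_⟩⟩
    · rw [lt_div_iff₀ h3]
      by_contra hcon
      have g1 : (i : ℝ) + j + 1 ≤ A + D := by linarith
      have g2 : i + j + 1 ≤ k := Int.le_floor.2 (by push_cast; exact g1)
      have g3 : j ≤ l := Int.le_floor.2 (by linarith)
      omega
    · apply div_neg_of_neg_of_pos _ h3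
      have : (j : ℝ) ≤ -1 := by exact_mod_cast (by omega : j ≤ -1)
      linarith
    · linarith
    · linarith
    · simp only [frame, pt_inj]
      push_cast
      constructor
      · rw [eq_div_iff h3.ne', hA]
        ring
      · ring
  · rw [show (2 * j + 1) / 2 = j by omega, show (2 * j + 1 + 1) / 2 = j + 1 by omega] at hs3
    rw [show (2 * j + 1 + 1) / 2 = j + 1 by omega,
      show (2 * j + 1 + 1 + 1) / 2 = j + 1 by omega] at hs4
    have hside : IsSide n ⟨i + 1, j + 1, -1, 0⟩ := by
      apply isSide_of_left_right
      · simp [HasUnitStep]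
      · convert hs3 using 1
        simp [left]
        ring
      · convert hs4 using 1
        simp [right]
        ring_nf
    refine ⟨((j : ℝ) + 1) / 3 ^ n, ?_, ?_, mem_KS_iff.2 ⟨_, hside, i + 1 - A, ?_, ?_, ?_⟩⟩
    · rw [lt_div_iff₀ h3]
      by_contra hcon
      have g1 : (j : ℝ) + 1 ≤ D := by linarith
      have g3 : j + 1 ≤ l := Int.le_floor.2 (by push_cast; exact g1)
      have g2 : i + (j + 1) ≤ k := Int.le_floor.2 (by push_cast; linarith)
      omega
    · apply div_neg_of_neg_of_pos _ h3
      have : (j : ℝ) ≤ -2 := by exact_mod_cast (by omega : j ≤ -2)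
      linarith
    · linarith
    · linarith
    · simp only [frame, pt_inj]
      push_cast
      constructor
      · rw [eq_div_iff h3.ne', hA]
        ring
      · ring

/-- The ball with the direction `π / 3` leaves the side `e` at the point `pt x β`, below or at the
point `x` of the base, and everything in between is safe. -/
structure IsStart (n : ℕ) (c : Bool) (e : LatticeEdge) (x β : ℝ) : Prop where
  v_eq : e.v = 1
  w_eq : e.w = bif c then 0 else -1
  p_eq : e.p = ⌊3 ^ n * x⌋
  nonpos : β ≤ 0
  frame_eq : frame n e (Int.fract (3 ^ n * x)) 0 = pt x β
  safe : ∀ b, β < b → b ≤ 0 → Safe n (pt x b)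

theorem IsStart.outDir_eq {n : ℕ} {c : Bool} {e : LatticeEdge} {x β : ℝ}
    (h : IsStart n c e x β) : outDir c e = dir (Real.pi / 3) := by
  have hv := h.v_eq
  have hw := h.w_eq
  cases c <;> simp [outDir, hv, hw, dir_eq_pt]

theorem fract_pos_of_ne_int {a : ℝ} (h : ∀ k : ℤ, a ≠ k) : 0 < Int.fract a := by
  refine lt_of_le_of_ne (Int.fract_nonneg a) fun h0 => h ⌊a⌋ ?_
  have := Int.floor_add_fract a
  linarith

theorem sbtw_pt {x b b' : ℝ} (h : (b < b' ∧ b' < 0) ∨ (0 < b' ∧ b' < b)) :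
    Sbtw ℝ (pt x 0) (pt x b') (pt x b) := by
  have hb : b ≠ 0 := by rcases h with h | h <;> intro h0 <;> linarith
  refine ⟨⟨b' / b, ⟨?_, ?_⟩, ?_⟩, ?_, ?_⟩
  · rcases h with h | h
    · exact (div_pos_of_neg_of_neg h.2 (by linarith)).le
    · exact (div_pos h.1 (by linarith)).le
  · rcases h with h | h
    · exact (div_le_one_of_neg (by linarith)).2 h.1.le
    · exact (div_le_one (by linarith)).2 h.2.le
  · rw [AffineMap.lineMap_apply, vsub_eq_sub, vadd_eq_add, Complex.real_smul]
    have : pt x b - pt x 0 = pt 0 b := by simp [pt]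
    rw [this, add_comm, pt_add_mul, pt_inj]
    constructor
    · ring
    · field_simp
      ring
  · rw [ne_eq, pt_inj]
    rcases h with h | h <;> intro h0 <;> linarith [h0.2]
  · rw [ne_eq, pt_inj]
    rcases h with h | h <;> intro h0 <;> linarith [h0.2]

/-- A lower base point would be hidden by the side `e`, or, when β = 0, by the side where the column
leaves the table. Strictly inside the first flight there is no curve; at its end the direction
points outwards; and beyond it `e'` blocks the view. -/
theorem IsStart.eq_of_visible {n : ℕ} {c : Bool} {e e' : LatticeEdge} {x β b B : ℝ}
    (h : IsStart n c e x β) (hx : ∀ k : ℤ, 3 ^ n * x ≠ k) (he : IsSide n e) (he' : IsSide n e')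
    (hc : DirChord n c B e e') (hin : PointsInward n (pt x b) (dir (Real.pi / 3)))
    (hvis : ∀ z, Sbtw ℝ (pt x 0) z (pt x b) → z ∉ KS n) : b = β := by
  have h3 : (0 : ℝ) < 3 ^ n := by positivity
  have h0 := fract_pos_of_ne_int hx
  have h1 := Int.fract_lt_one (3 ^ n * x)
  have hfl := Int.floor_add_fract (3 ^ n * x)
  obtain ⟨hT, harr, hsafe⟩ := hc.flight h0 h1
  have hframe := h.frame_eq
  simp only [hframe, h.outDir_eq, pt_add_dir] at harr hsafe
  set T := flightTime n c B (Int.fract (3 ^ n * x))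
  have hbKS : pt x b ∈ KS n := by
    obtain ⟨⟨s, hs, hz⟩, -⟩ := hin
    exact ⟨s, hs, openSegment_subset_segment _ _ _ hz⟩
  have hend : pt x (β + T) ∈ KS n :=
    mem_KS_iff.2 ⟨e', he', _, by linarith, by linarith, harr⟩
  have hstart : pt x β ∈ KS n := mem_KS_iff.2 ⟨e, he, _, h0.le, h1.le, hframe.symm⟩
  have hend0 : 0 < β + T := by
    by_contra hcon
    exact (h.safe (β + T) (by linarith) (by linarith)).notMem_KS hend
  have hin' := inTable_of_pointsInward hx hin
  rcases lt_trichotomy b β with hlt | heq | hgt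
  · exfalso
    rcases h.nonpos.lt_or_eq with hβ | hβ
    · exact hvis _ (sbtw_pt (Or.inl ⟨hlt, hβ⟩)) hstart
    · have hB := congrArg (fun z => 3 ^ n * coordB z) hframe
      simp only [coordB_frame, coordB_pt, hβ, h.w_eq, h.v_eq] at hB
      have hout : ¬ InTable n (⌊3 ^ n * x⌋, -1, ⌊3 ^ n * x⌋) := by
        convert he.right_not_inTable using 2
        have hv := h.v_eq
        have hw := h.w_eq
        have hp := h.p_eq
        cases c
        -- For `c = false` the side is transversal to the base line, and an inner point at height 0
        -- would make the integer `e.q` equal to the fractional part u.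
        · exfalso
          simp only [cond_false] at hB
          push_cast at hB
          have a1 : 0 < e.q := by exact_mod_cast (by linarith : (0 : ℝ) < e.q)
          have a2 : e.q < 1 := by exact_mod_cast (by linarith : (e.q : ℝ) < 1)
          omega
        · simp only [cond_true] at hB hw
          push_cast at hB
          have hq : e.q = 0 := by exact_mod_cast (by linarith : (e.q : ℝ) = 0)
          simp [right, hv, hw, hp, hq]
      obtain ⟨b', hb1, hb2, hb3⟩ := exists_mem_KS_of_inTable hx (hβ ▸ hlt) hin' hout
      exact hvis _ (sbtw_pt (Or.inl ⟨hb1, hb2⟩)) hb3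
  · exact heq
  · exfalso
    rcases lt_trichotomy b (β + T) with hbT | hbT | hbT
    · have := hsafe (b - β) (by linarith) (by linarith)
      rw [show β + (b - β) = b by ring] at this
      exact this.notMem_KS hbKS
    -- Going on past the far end of the chord means entering the triangle on the right of `e'`,
    -- which is outside the table.
    · rw [← hbT] at harr
      have hA := congrArg (fun z => 3 ^ n * coordA z) harr
      have hB := congrArg (fun z => 3 ^ n * coordB z) harr
      simp only [coordA_frame, coordB_frame, coordA_pt, coordB_pt] at hA hB
      apply he'.right_not_inTable
      convert hin' using 1
      have hv := h.v_eq
      have hw := h.w_eq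
      rw [mul_add]
      generalize 3 ^ n * x = A at *
      generalize 3 ^ n * b = D at *
      have hvw : e'.v = -1 ∧ (e'.w = 1 ∨ e'.w = 0) := by
        cases c
        · have g1 := Chord.v_eq hc
          have g2 := Chord.w_eq hc
          simp only [cond_false] at hw
          omega
        · have g1 := Chord.v_eq hc
          have g2 := Chord.w_eq hc
          simp only [cond_true] at hw
          omega
      obtain ⟨hv', hw' | hw'⟩ := hvw
      · rw [hv', hw'] at hA hB
        push_cast at hA hB
        have g1 : ⌊A⌋ = e'.p - 1 := Int.floor_eq_iff.2 (by push_cast; constructor <;> linarith)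
        have g2 : ⌊D⌋ = e'.q := Int.floor_eq_iff.2 (by constructor <;> linarith)
        have g3 : ⌊A + D⌋ = e'.p + e'.q :=
          Int.floor_eq_iff.2 (by push_cast; constructor <;> linarith)
        rw [g1, g2, g3]
        simp [right, hv', hw']
        ring
      · rw [hv', hw'] at hA hB
        push_cast at hA hB
        have g1 : ⌊A⌋ = e'.p - 1 := Int.floor_eq_iff.2 (by push_cast; constructor <;> linarith)
        have g2 : ⌊D⌋ = e'.q := Int.floor_eq_iff.2 (by constructor <;> linarith)
        have g3 : ⌊A + D⌋ = e'.p + e'.q - 1 :=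
          Int.floor_eq_iff.2 (by push_cast; constructor <;> linarith)
        rw [g1, g2, g3]
        simp [right, hv', hw']
        constructor <;> ring
    · exact hvis _ (sbtw_pt (Or.inr ⟨hend0, hbT⟩)) hend

section Step

variable {n : ℕ} {c : Bool} {e : LatticeEdge} {x β : ℝ} {d : ℕ → Fin 3}

theorem IsStart.third (h : IsStart n c e x β) (hd : x = Real.ofDigits d)
    (hx : ∀ m, ∀ k : ℤ, 3 ^ m * x ≠ k) {b : Bool} (hb : (d n : ℕ) = bif b then 2 else 0) :
    IsStart (n + 1) c (e.third b) x β := by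
  have h1 := three_mul_fract_eq hd n hx
  have h2 := floor_pow_succ_eq hd n hx
  have hv := h.v_eq
  have hw := h.w_eq
  have hp := h.p_eq
  have hfr := h.frame_eq
  cases b
  · simp only [hb, cond_false, CharP.cast_eq_zero, zero_add, add_zero] at h1 h2
    refine ⟨hv, hw, ?_, h.nonpos, ?_, fun b hb hb0 => (h.safe b hb hb0).succ⟩
    · simp [LatticeEdge.third, LatticeEdge.first, hp, h2]
    · simp only [LatticeEdge.third, cond_false]
      rw [frame_first, ← hfr]
      congr 1 <;> linarith
  · simp only [hb, cond_true, Nat.cast_ofNat] at h1 h2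
    refine ⟨hv, hw, ?_, h.nonpos, ?_, fun b hb hb0 => (h.safe b hb hb0).succ⟩
    · simp [LatticeEdge.third, LatticeEdge.last, hp, h2, hv]
    · simp only [LatticeEdge.third, cond_true]
      rw [frame_last, ← hfr]
      congr 1 <;> linarith

/-- The line of sight is prolonged backwards through the open middle third to the free side of the
cell; by `safe_cell` the added piece is safe on the new level. -/
theorem IsStart.cellSide (h : IsStart n c e x β) (he : IsSide n e) (hd : x = Real.ofDigits d)
    (hx : ∀ m, ∀ k : ℤ, 3 ^ m * x ≠ k) (hdn : (d n : ℕ) = 1) :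
    ∃ β', IsStart (n + 1) (!c) (e.cellSide c) x β' := by
  have h1 := three_mul_fract_eq hd n hx
  have h2 := floor_pow_succ_eq hd n hx
  have hv := h.v_eq
  have hw := h.w_eq
  have hp := h.p_eq
  have hfr := h.frame_eq
  have hu0 := fract_pos_of_ne_int (hx (n + 1))
  have hu1 := Int.fract_lt_one (3 ^ (n + 1) * x)
  have h3 : (0 : ℝ) < 3 ^ n := by positivity
  simp only [hdn, Nat.cast_one] at h1 h2
  set u := Int.fract (3 ^ n * x)
  set u' := Int.fract (3 ^ (n + 1) * x)
  have hline : ∀ b, pt x b = frame n e u 0 + ((b - β : ℝ) : ℂ) * outDir c e := by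
    intro b
    rw [hfr, h.outDir_eq, pt_add_dir]
    congr 1
    ring
  have hsafe : ∀ b, b ≤ 0 → (b ≤ β → Safe (n + 1) (pt x b)) → Safe (n + 1) (pt x b) := by
    intro b hb0 hs
    rcases le_or_gt b β with hb | hb
    · exact hs hb
    · exact (h.safe b hb hb0).succ
  cases c
  -- The line enters at (1 + u')/3 on `e`; by `frame_fromApex` the free side lies (1 - u')/3 behind,
  -- in the unit 3⁻ⁿ.
  · refine ⟨β - (1 - u') / 3 / 3 ^ n, ?_, ?_, ?_, ?_, ?_, fun b hb hb0 => hsafe b hb0 fun hbβ => ?_⟩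
    · simp [LatticeEdge.cellSide, LatticeEdge.fromApex, hw]
    · simp [LatticeEdge.cellSide, LatticeEdge.fromApex, hv, hw]
    · simp only [LatticeEdge.cellSide, LatticeEdge.fromApex, hv, hw, cond_false, hp, h2]
      ring
    · have : 0 ≤ (1 - u') / 3 / 3 ^ n := by
        have : 0 ≤ 1 - u' := by linarith
        positivity
      linarith [h.nonpos]
    · rw [hline, frame_add_outDir_false]
      simp only [LatticeEdge.cellSide, cond_false]
      rw [frame_fromApex]
      congr 1 <;> field_simp <;> linarith
    · rw [hline, frame_add_outDir_false]
      have hb1 : -(1 - u') / 3 < 3 ^ n * (b - β) := by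
        have : -((1 - u') / 3 / 3 ^ n) < b - β := by linarith
        have := mul_lt_mul_of_pos_left this h3
        rw [mul_neg, mul_div_cancel₀ _ h3.ne'] at this
        linarith
      have hb2 : 3 ^ n * (b - β) ≤ 0 := mul_nonpos_of_nonneg_of_nonpos h3.le (by linarith)
      exact safe_cell he (by linarith) (by linarith) (by linarith)
  -- By `frame_toApex` the depth of this free side is u'/3.
  · refine ⟨β - u' / 3 / 3 ^ n, ?_, ?_, ?_, ?_, ?_, fun b hb hb0 => hsafe b hb0 fun hbβ => ?_⟩
    · simp [LatticeEdge.cellSide, LatticeEdge.toApex, hv, hw]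
    · simp [LatticeEdge.cellSide, LatticeEdge.toApex, hv]
    · simp only [LatticeEdge.cellSide, LatticeEdge.toApex, hv, cond_true, hp, h2]
    · have : 0 ≤ u' / 3 / 3 ^ n := by positivity
      linarith [h.nonpos]
    · rw [hline, frame_add_outDir_true]
      simp only [LatticeEdge.cellSide, cond_true]
      rw [frame_toApex]
      congr 1
      · linarith
      · field_simp
        linarith
    · rw [hline, frame_add_outDir_true]
      have hb1 : -u' / 3 < 3 ^ n * (b - β) := by
        have : -(u' / 3 / 3 ^ n) < b - β := by linarith
        have := mul_lt_mul_of_pos_left this h3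
        rw [mul_neg, mul_div_cancel₀ _ h3.ne'] at this
        linarith
      have hb2 : 3 ^ n * (b - β) ≤ 0 := mul_nonpos_of_nonneg_of_nonpos h3.le (by linarith)
      exact safe_cell he (by linarith) (by linarith) (by linarith)

theorem isStart_triangle (hx0 : 0 < x) (hx1 : x < 1) :
    IsStart 0 true (triangleItinerary 0) x 0 := by
  have hfl : ⌊x⌋ = 0 := Int.floor_eq_zero_iff.2 ⟨hx0.le, hx1⟩
  have hfr : Int.fract x = x := Int.fract_eq_self.2 ⟨hx0.le, hx1⟩
  refine ⟨rfl, rfl, ?_, le_rfl, ?_, fun b h1 h2 => absurd h1 (by linarith)⟩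
  · simp [triangleItinerary, hfl]
  · simp [triangleItinerary, frame, hfr]

end Step

/-! ### Lengths in the equilateral triangle. -/

section Triangle

variable {u : ℝ} {q : ℕ → ℂ × ℂ}

theorem pathLength_triangle_of_ne (h0 : 0 < u) (h1 : u < 1) (hu : u ≠ 1 / 2)
    (hq0 : q 0 = (frame 0 (triangleItinerary 0) u 0, outDir true (triangleItinerary 0)))
    (hq : ∀ k, BilliardStep 0 (q k) (q (k + 1))) : pathLength q = 3 := by
  have hper : period q = 6 :=
    triangleItinerary_isItinerary.period_eq h0 h1 hq0 hq (by norm_num) fun k => by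
      simp only [hu, or_false]
      omega
  rw [triangleItinerary_isItinerary.pathLength_eq h0 h1 hq0 hq, hper]
  simp only [Finset.sum_range_succ, Finset.sum_range_zero, flightTime, altCoord_succ, cond_true]
  ring

theorem pathLength_triangle_of_eq (hu : u = 1 / 2)
    (hq0 : q 0 = (frame 0 (triangleItinerary 0) u 0, outDir true (triangleItinerary 0)))
    (hq : ∀ k, BilliardStep 0 (q k) (q (k + 1))) : pathLength q = 3 / 2 := by
  have h0 : 0 < u := by rw [hu]; norm_num
  have h1 : u < 1 := by rw [hu]; norm_num
  have hper : period q = 3 :=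
    triangleItinerary_isItinerary.period_eq h0 h1 hq0 hq (by norm_num) fun k => by simp [hu]
  rw [triangleItinerary_isItinerary.pathLength_eq h0 h1 hq0 hq, hper]
  simp only [Finset.sum_range_succ, Finset.sum_range_zero, flightTime, altCoord_succ, cond_true]
  simp only [altCoord, Nat.bodd_zero, cond_false, hu]
  norm_num

end Triangle

/-! ### Induction over the levels and the length formula. -/

section Sequence

variable {O : ℕ → ℕ → ℂ × ℂ} {x : ℝ} {d : ℕ → Fin 3}

theorem IsCompatiblePeriodicSequence.exists_pt
    (hO : IsCompatiblePeriodicSequence (Real.pi / 3) O) (hx0 : (O 0 0).1 = pt x 0) (n : ℕ) :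
    ∃ b, (O n 0).1 = pt x b := by
  obtain ⟨t, ht⟩ := hO.collinear n
  exact ⟨0 + t, by rw [ht, hx0, pt_add_dir]⟩

theorem IsCompatiblePeriodicSequence.ne_int
    (hO : IsCompatiblePeriodicSequence (Real.pi / 3) O) (hx0 : (O 0 0).1 = pt x 0) (n : ℕ)
    (k : ℤ) : 3 ^ n * x ≠ k := by
  obtain ⟨b, hb⟩ := hO.exists_pt hx0 n
  have hin := (hO.orbit n).inward
  have hstep := (hO.orbit n).step 0
  rw [(hO.orbit n).init] at hstep
  rw [hb] at hin hstep
  exact ne_int_of_billiardStep hin hstep k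

/-- The orbit starts as described by an itinerary. -/
theorem IsCompatiblePeriodicSequence.init_eq
    (hO : IsCompatiblePeriodicSequence (Real.pi / 3) O) (hx0 : (O 0 0).1 = pt x 0) {n : ℕ}
    {c : Bool} {σ : ℕ → LatticeEdge} {B : ℕ → ℝ} {N : ℕ} (h : IsItinerary n c σ B N) {β : ℝ}
    (hs : IsStart n c (σ 0) x β) :
    O n 0 = (frame n (σ 0) (Int.fract (3 ^ n * x)) 0, outDir c (σ 0)) := by
  obtain ⟨b, hb⟩ := hO.exists_pt hx0 n
  have hin := (hO.orbit n).inward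
  have hvis := hO.visible n
  rw [hb] at hin hvis
  rw [hx0] at hvis
  have hbβ := hs.eq_of_visible (hO.ne_int hx0 n) (h.side 0) (h.side 1) (h.chord 0) hin hvis
  rw [(hO.orbit n).init, hb, hbβ, hs.frame_eq, hs.outDir_eq]

/-- The invariant of the induction. It begins at level 1 because there N is even for the first time,
which makes N the period and the left-hand side the length. -/
theorem IsCompatiblePeriodicSequence.exists_itinerary
    (hO : IsCompatiblePeriodicSequence (Real.pi / 3) O) (hx0 : (O 0 0).1 = pt x 0)
    (hd : x = Real.ofDigits d) (n : ℕ) :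
    ∃ (c : Bool) (σ : ℕ → LatticeEdge) (B : ℕ → ℝ) (N : ℕ) (β : ℝ),
      IsItinerary (n + 1) c σ B N ∧ 0 < N ∧ 2 ∣ N ∧ IsStart (n + 1) c (σ 0) x β ∧
      (∑ j ∈ Finset.range N, B j - N / 2) / 3 ^ (n + 1) =
        3 + ∑ i ∈ Finset.Icc 2 (n + 1), chi (d (i - 1)) * (period (O (i - 1)) : ℝ) *
          ((3 / 2) / 3 ^ i) := by
  have hx := hO.ne_int hx0
  have hdigit : ∀ m, (∃ b : Bool, (d m : ℕ) = bif b then 2 else 0) ∧ chi (d m) = 0 ∨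
      (d m : ℕ) = 1 ∧ chi (d m) = 1 := by
    intro m
    generalize d m = a
    fin_cases a
    · exact Or.inl ⟨⟨false, rfl⟩, by simp [chi]⟩
    · exact Or.inr ⟨rfl, by simp [chi]⟩
    · exact Or.inl ⟨⟨true, rfl⟩, by simp [chi]⟩
  induction n with
  | zero =>
    have hI := triangleItinerary_isItinerary
    have hs : IsStart 0 true (triangleItinerary 0) x 0 := by
      have g0 := hx 0 0
      have g1 := hx 0 1
      have g2 := Real.ofDigits_nonneg d
      have g3 := Real.ofDigits_le_one d
      rw [← hd] at g2 g3
      simp only [pow_zero, one_mul, Int.cast_zero, Int.cast_one] at g0 g1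
      exact isStart_triangle (lt_of_le_of_ne g2 g0.symm) (lt_of_le_of_ne g3 g1)
    -- The odd period 3 becomes 6 either way, through lcm(3, 2) or 2·3, and both cases give the
    -- length 3.
    rcases hdigit 0 with ⟨⟨b, hb⟩, -⟩ | ⟨hd1, -⟩
    · refine ⟨_, _, _, _, 0, hI.third b, by decide, by decide, ?_, ?_⟩
      · simpa using hs.third hd hx hb
      · rw [show Nat.lcm 3 2 = 6 by decide, sum_third _ _ _ (by norm_num)]
        norm_num
    · obtain ⟨β, hβ⟩ := hs.cellSide (hI.side 0) hd hx hd1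
      refine ⟨_, _, _, _, β, hI.cellSide, by norm_num, by norm_num, ?_, ?_⟩
      · simpa using hβ
      · rw [sum_cellSide (fun _ => 1) 3]
        norm_num
  | succ n ih =>
    obtain ⟨c, σ, B, N, β, hI, hN, hN2, hs, hsum⟩ := ih
    have hper : period (O (n + 1)) = N :=
      hI.period_eq_of_even (fract_pos_of_ne_int (hx _)) (Int.fract_lt_one _)
        (hO.init_eq hx0 hI hs) (hO.orbit _).step hN hN2
    have h3 : (3 : ℝ) ^ (n + 1) ≠ 0 := by positivity
    rw [div_eq_iff h3] at hsum
    rcases hdigit (n + 1) with ⟨⟨b, hb⟩, hchi⟩ | ⟨hd1, hchi⟩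
    -- The length is unchanged, as 3∑B - N - N/2 = 3(∑B - N/2).
    · have hlcm : N.lcm 2 = N := Nat.lcm_eq_left hN2
      refine ⟨_, _, _, _, β, hlcm ▸ hI.third b, hN, hN2, ?_, ?_⟩
      · simpa using hs.third hd hx hb
      · rw [sum_third _ _ _ hN2, Finset.sum_Icc_succ_top (by omega), Nat.add_sub_cancel, hchi,
          div_eq_iff (by positivity), pow_succ]
        linear_combination 3 * hsum
    -- Here 3∑B + N - N = 3(∑B - N/2) + 3N/2, so the gain is N·(3/2)/3ⁿ⁺², with N the period on the
    -- previous level.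
    · obtain ⟨β', hβ⟩ := hs.cellSide (hI.side 0) hd hx hd1
      refine ⟨_, _, _, _, β', hI.cellSide, by omega, by simp, ?_, ?_⟩
      · simpa using hβ
      · rw [sum_cellSide, Finset.sum_Icc_succ_top (by omega), Nat.add_sub_cancel, hchi, hper,
          div_eq_iff (by positivity), pow_succ (3 : ℝ) (n + 1)]
        generalize ∑ i ∈ Finset.Icc 2 (n + 1), chi (d (i - 1)) * (period (O (i - 1)) : ℝ) *
          ((3 / 2) / 3 ^ i) = S at *
        push_cast
        field_simp
        linear_combination 6 * hsum

end Sequence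

end KochBilliard

/-- `O` is a compatible sequence of periodic orbits in the direction `π/3`, `F` is the Fagnano orbit
of the equilateral triangle, and `0.d₀d₁d₂…` is a ternary expansion of the initial base point of
`O 0` in the base `[0,1]`, so that its `i`-th character is `d (i - 1)`. -/
theorem mainTheorem5 (O : ℕ → ℕ → ℂ × ℂ)
    (hO : KochBilliard.IsCompatiblePeriodicSequence (Real.pi / 3) O)
    (F : ℕ → ℂ × ℂ) (hF : KochBilliard.IsOrbit 0 (1 / 2) (Real.pi / 3) F)
    (d : ℕ → Fin 3) (hd : (O 0 0).1 = ((Real.ofDigits d : ℝ) : ℂ)) :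
    (∀ n : ℕ, (n ≠ 0 ∨ (O 0 0).1 ≠ 1 / 2) →
      KochBilliard.pathLength (O n) =
        2 * KochBilliard.pathLength F +
          ∑ i ∈ Finset.Icc 2 n, KochBilliard.chi (d (i - 1)) *
            (KochBilliard.period (O (i - 1)) : ℝ) * (KochBilliard.pathLength F / 3 ^ i)) ∧
    ((O 0 0).1 = 1 / 2 →
      KochBilliard.pathLength (O 0) = KochBilliard.pathLength F) := by
  open KochBilliard in
  obtain ⟨x, hx⟩ : ∃ x, x = Real.ofDigits d := ⟨_, rfl⟩
  have hx0 : (O 0 0).1 = pt x 0 := by rw [hd, hx]; simp [pt]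
  have hne := hO.ne_int hx0
  have hpos : 0 < x := by
    have g0 := hne 0 0
    have g2 := Real.ofDigits_nonneg d
    rw [← hx] at g2
    simp only [pow_zero, one_mul, Int.cast_zero] at g0
    exact lt_of_le_of_ne g2 g0.symm
  have hlt : x < 1 := by
    have g1 := hne 0 1
    have g3 := Real.ofDigits_le_one d
    rw [← hx] at g3
    simp only [pow_zero, one_mul, Int.cast_one] at g1
    exact lt_of_le_of_ne g3 g1
  have hstart : ∀ y : ℝ, 0 < y → y < 1 → pt y 0 = frame 0 (triangleItinerary 0) y 0 := by
    intro y _ _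
    simp [triangleItinerary, frame]
  have hdir : outDir true (triangleItinerary 0) = dir (Real.pi / 3) :=
    (isStart_triangle hpos hlt).outDir_eq
  have hFL : pathLength F = 3 / 2 := by
    refine pathLength_triangle_of_eq rfl ?_ hF.step
    rw [hF.init, hdir, ← hstart _ (by norm_num) (by norm_num)]
    simp [pt]
  have hO0 : O 0 0 = (frame 0 (triangleItinerary 0) x 0, outDir true (triangleItinerary 0)) := by
    rw [(hO.orbit 0).init, hx0, hdir, ← hstart x hpos hlt]
  have hhalf : (O 0 0).1 = 1 / 2 ↔ x = 1 / 2 := by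
    rw [hd, ← hx, ← Complex.ofReal_inj]
    push_cast
    rfl
  simp only [hFL, ne_eq, hhalf]
  refine ⟨fun n hn => ?_, fun h => pathLength_triangle_of_eq h hO0 (hO.orbit 0).step⟩
  cases n with
  | zero =>
    have hx2 : x ≠ 1 / 2 := by simpa using hn
    rw [pathLength_triangle_of_ne hpos hlt hx2 hO0 (hO.orbit 0).step]
    norm_num
  | succ n =>
    obtain ⟨c, σ, B, N, β, hI, hN, hN2, hs, hsum⟩ := hO.exists_itinerary hx0 hx n
    rw [hI.pathLength_eq_of_even (fract_pos_of_ne_int (hne _)) (Int.fract_lt_one _)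
      (hO.init_eq hx0 hI hs) (hO.orbit _).step hN hN2, hsum]
    norm_num
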